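/- Let $d\ge 2$ and let $\mathrm{Poly}_d\cong\{(b_0,\dots,b_d)\in\mathbb{C}^{d+1}: b_d\ne 0\}$ be the complex manifold of all polynomials $\sum_i b_i z^i$ of degree $d$. For $P\in\mathrm{Poly}_d$ let $\mathcal{C}(P)$ be the set of critical points of $P$ in $\mathbb{C}$, and let $\mathcal{O}(P)\subset\mathrm{Poly}_d$ be the set of all $A^{-1}\circ P\circ A$ with $A(z)=\alpha z+\beta$, $\alpha\neq0$. Let $P\in\mathrm{Poly}_d$ have only simple critical points ($P''(c)\ne0$ whenever $P'(c)=0$) and be strictly postcritically finite (each critical point has a finite forward orbit and is not periodic). Let $V\subset\mathrm{Poly}_d$ be an open neighborhood of $P$ and $c_0,\dots,c_{d-2}:V\to\mathbb{C}$ holomorphic functions with $\{c_0(Q),\dots,c_{d-2}(Q)\}=\mathcal{C}(Q)$ for all $Q\in V$. Let $m_i>n_i\ge1$ ($0\le i\le d-2$) be integers, and assume, writing $c_i$ for $c_i(P)$: 1. if $c_i\ne c_j$, then $P^k(c_i)\ne P^l(c_j)$ for all $k,l\ge0$; 2. for each $i$, $P^k(c_i)$ is periodic if and only if $k\ge n_i$,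 and its period is then exactly $m_i-n_i$. Define holomorphic maps $\mathfrak{n},\mathfrak{m}:V\to\mathbb{C}^{d-1}$ by $\mathfrak{n}(Q)=(Q^{n_i}(c_i(Q)))_i$ and $\mathfrak{m}(Q)=(Q^{m_i}(c_i(Q)))_i$. Then $$\ker(D_P\mathfrak{n}-D_P\mathfrak{m})=T_P\mathcal{O}(P),$$ where $T_P\mathcal{O}(P)$ is the set of velocities at $P$ of holomorphic discs in $\mathcal{O}(P)$ through $P$. Moreover, the $d-1$ local hypersurfaces $\{Q\in V: Q^{m_i}(c_i(Q))=Q^{n_i}(c_i(Q))\}$, $0\le i\le d-2$, are smooth at $P$ and transverse at $P$ (the codimension of the intersection of their tangent spaces at $P$ is the sum of their codimensions); in fact the differentials at $P$ of their defining functions $Q\mapsto Q^{m_i}(c_i(Q))-Q^{n_i}(c_i(Q))$ are linearly independent. -/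

import Mathlib

namespace PolyFamily

/-- Coefficient vectors `(b₀, …, b_d)` of polynomials `∑ bᵢ zⁱ` of degree at most `d`. This is
the ambient complex vector space of the family of all polynomials of degree `d`. -/
abbrev Coeffs (d : ℕ) : Type := Fin (d + 1) → ℂ

/-- The family `Poly_d` of all polynomials of degree exactly `d`: the open set of coefficient
vectors with nonzero leading coefficient. As it is open, each of its tangent spaces
is the whole of `Coeffs d`. -/
def polyDeg (d : ℕ) : Set (Coeffs d) := {b | b (Fin.last d) ≠ 0}

/-- The polynomial with coefficient vector `b`. -/
noncomputable def toPoly {d : ℕ} (b : Coeffs d) : Polynomial ℂ :=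
  ∑ i : Fin (d + 1), Polynomial.monomial (i : ℕ) (b i)

/-- The self-map of `ℂ` given by the polynomial with coefficient vector `b`. -/
noncomputable def polyMap {d : ℕ} (b : Coeffs d) : ℂ → ℂ := fun z => (toPoly b).eval z

/-- The set of critical points of a polynomial. -/
def criticalSet {d : ℕ} (b : Coeffs d) : Set ℂ := {z | (toPoly b).derivative.eval z = 0}

/-- All critical points are simple: the second derivative does not vanish there. -/
def HasSimpleCriticalPoints {d : ℕ} (b : Coeffs d) : Prop :=
  ∀ z ∈ criticalSet b, (toPoly b).derivative.derivative.eval z ≠ 0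

/-- Strictly postcritically finite: each critical point has a finite forward orbit
and is not periodic. -/
def StrictlyPostcriticallyFinite {d : ℕ} (b : Coeffs d) : Prop :=
  ∀ z ∈ criticalSet b,
    (Set.range fun k : ℕ => (polyMap b)^[k] z).Finite ∧ z ∉ Function.periodicPts (polyMap b)

/-- The affine conjugacy class of `P` in `Poly_d`: all `Q = A⁻¹ ∘ P ∘ A` where `A z = α z + β`
and `α ≠ 0`. -/
def affineOrbit {d : ℕ} (P : Coeffs d) : Set (Coeffs d) :=
  {Q | Q ∈ polyDeg d ∧ ∃ α β : ℂ, α ≠ 0 ∧ ∀ z : ℂ, α * polyMap Q z + β = polyMap P (α * z + β)}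

/-- A marking of the critical points on `V`: holomorphic functions `c₀, …, c_{d-2}` on `V`
whose values at each `Q ∈ V` are exactly the critical points of `Q`. -/
structure IsCriticalMarking {d : ℕ} (V : Set (Coeffs d)) (c : Fin (d - 1) → Coeffs d → ℂ) :
    Prop where
  holomorphic : ∀ i, DifferentiableOn ℂ (c i) V
  range_eq : ∀ Q ∈ V, Set.range (fun i => c i Q) = criticalSet Q

/-- The map `Q ↦ (Q^{k₀}(c₀(Q)), …, Q^{k_{d-2}}(c_{d-2}(Q)))`. -/
noncomputable def critIterates {d : ℕ} (c : Fin (d - 1) → Coeffs d → ℂ) (k : Fin (d - 1) → ℕ) :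
    Coeffs d → (Fin (d - 1) → ℂ) :=
  fun Q i => (polyMap Q)^[k i] (c i Q)

/-- The local hypersurface `{Q ∈ V : Q^{m}(cᵢ(Q)) = Q^{n}(cᵢ(Q))}` for `m = mᵢ` and `n = nᵢ`. -/
def relationHypersurface {d : ℕ} (V : Set (Coeffs d)) (c : Fin (d - 1) → Coeffs d → ℂ)
    (m n : Fin (d - 1) → ℕ) (i : Fin (d - 1)) : Set (Coeffs d) :=
  {Q | Q ∈ V ∧ critIterates c m Q i = critIterates c n Q i}

section Tangent

variable {E : Type*} [NormedAddCommGroup E] [NormedSpace ℂ E]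

/-- The tangent vectors at `x` to a subset `S` of a complex vector space: the velocities at `0`
of germs of holomorphic discs through `x` contained in `S`. For a complex submanifold `S` this
is its holomorphic tangent space at `x`. -/
def tangentVectors (S : Set E) (x : E) : Set E :=
  {v | ∃ φ : ℂ → E, AnalyticAt ℂ φ 0 ∧ φ 0 = x ∧ (∀ᶠ t in nhds (0 : ℂ), φ t ∈ S) ∧
    deriv φ 0 = v}

/-- `H` is a smooth complex hypersurface at `x`: it passes through `x` and near `x` it is the
zero set of a holomorphic function with nonzero differential at `x`. -/
def IsSmoothHypersurfaceAt (H : Set E) (x : E) : Prop :=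
  x ∈ H ∧ ∃ (U : Set E) (f : E → ℂ), IsOpen U ∧ x ∈ U ∧ DifferentiableOn ℂ f U ∧
    H ∩ U = {y | y ∈ U ∧ f y = 0} ∧ fderiv ℂ f x ≠ 0

/-- The linear tangent space at `x`, spanned by the tangent vectors (and equal to the set of
them if `S` is a submanifold). -/
def tangentSpaceAt (S : Set E) (x : E) : Submodule ℂ E := Submodule.span ℂ (tangentVectors S x)

/-- A finite family of submanifolds is transverse at `x`: the codimension of the intersection of
the tangent spaces at `x` is the sum of their codimensions. -/
def TransverseAt {ι : Type*} [Fintype ι] (H : ι → Set E) (x : E) : Prop :=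
  Module.finrank ℂ (E ⧸ ⨅ i, tangentSpaceAt (H i) x) =
    ∑ i, Module.finrank ℂ (E ⧸ tangentSpaceAt (H i) x)

end Tangent

end PolyFamily

/-! A vector `v` moves the orbit x_k = P^k(c_i) with velocities satisfying ζ(k+1) = v(x_k) + P'(x_k)
ζ(k), and `v` lies in the kernel iff ζ(m_i) = ζ(n_i) for every i. Subtracting a vector b P + a -
P'·(bz + a), tangent to the conjugacy class, replaces `v` by a polynomial `u` of degree at most d -
2 (`exists_affine_correction`); the core is that then u = 0
(`eq_zero_of_critical_relations_preserved`).

The closing condition turns ζ into a function ξ on the postcritical set X, with ξ(P(c)) = u(c) at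
critical points c. Residues express u(x)/P'(x) through the values u(c), so the recursion becomes ξ =
Mξ with M depending only on P. The same residue calculus identifies row x of M with the poles of the
push-forward of dz²/(z - x). Hence 1 - M is singular only if a nonzero quadratic differential with
simple poles in X equals its push-forward (`eq_zero_of_fixed`).

Thurston's area argument excludes this (`eq_zero_of_eq_pushforward`): the mass of such a
differential on a disc of radius 2R is at most its mass on the preimage, which lies in the disc of
radius R. That mass is finite, so the differential vanishes on an annulus and, being rational,
everywhere. Thus ξ = 0, `u` vanishes at all d - 1 critical points, and u = 0.

Conversely, critical relations persist along the conjugacy class, so its tangent vectors lie in the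
kernel. Injectivity of the d - 1 differentials on the (d - 1)-dimensional slice of degree at most d
- 2 makes them independent, which gives smoothness and transversality. -/

open Polynomial MeasureTheory Topology

/-! ### Residue identities for polynomials -/

/-- The sum of the residues of `u / F` vanishes if `F` has simple roots and `deg F ≥ deg u + 2`. -/
theorem Polynomial.sum_roots_eval_div_eval_derivative_eq_zero {K : Type*} [Field K]
    [IsAlgClosed K] [DecidableEq K] {F u : K[X]}
    (hF : ∀ z, F.eval z = 0 → F.derivative.eval z ≠ 0) (hu : u.natDegree + 1 < F.natDegree) :
    ∑ z ∈ F.roots.toFinset, u.eval z / F.derivative.eval z = 0 := by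
  have hF0 : F ≠ 0 := by rintro rfl; simp at hu
  have hlead : F.leadingCoeff ≠ 0 := leadingCoeff_ne_zero.2 hF0
  have hnodup : F.roots.Nodup := by
    rw [Multiset.nodup_iff_count_le_one]
    intro z
    rw [count_roots]
    by_contra! h
    have := (one_lt_rootMultiplicity_iff_isRoot hF0).1 h
    exact hF z this.1 this.2
  set s := F.roots.toFinset with hs
  have hval : s.val = F.roots := by rw [hs, Multiset.toFinset_val, hnodup.dedup]
  have hfac : F = C F.leadingCoeff * Lagrange.nodal s id := by
    conv_lhs => rw [(IsAlgClosed.splits F).eq_prod_roots]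
    rw [Lagrange.nodal_eq, Finset.prod, hval]; rfl
  have hcard : s.card = F.natDegree := by
    rw [Finset.card, hval, ← (IsAlgClosed.splits F).natDegree_eq_card_roots]
  have hder : ∀ z ∈ s, F.derivative.eval z =
      F.leadingCoeff * ∏ j ∈ s.erase z, (z - j) := by
    intro z hz
    conv_lhs => rw [hfac]
    rw [derivative_C_mul, eval_C_mul]
    have := Lagrange.eval_nodal_derivative_eval_node_eq (v := (id : K → K)) hz
    simp only [id] at this
    rw [this, Lagrange.eval_nodal]; rfl
  have hdeg : u.degree < s.card := by
    refine lt_of_le_of_lt degree_le_natDegree ?_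
    rw [hcard]; exact_mod_cast (by omega : u.natDegree < F.natDegree)
  -- The sum is, up to the leading coefficient of `F`, the top coefficient (degree `s.card - 1`) of
  -- the interpolant of `u` at the roots, which is `u` itself; the degree gap kills it.
  have key := Lagrange.coeff_eq_sum (v := (id : K → K)) (Set.injOn_id _) hdeg
  rw [coeff_eq_zero_of_natDegree_lt (by omega)] at key
  rw [Finset.sum_congr rfl fun z hz => by rw [hder z hz]]
  simp only [id] at key
  have : ∀ z ∈ s, u.eval z / (F.leadingCoeff * ∏ j ∈ s.erase z, (z - j)) =
      F.leadingCoeff⁻¹ * (u.eval z / ∏ j ∈ s.erase z, (z - j)) := by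
    intro z _; rw [div_mul_eq_div_div_swap, div_eq_inv_mul]
  rw [Finset.sum_congr rfl this, ← Finset.mul_sum, ← key, mul_zero]

/-- Partial fraction expansion of `u / p'` at a point `x`. -/
theorem Polynomial.sum_critical_eval_div {p u : ℂ[X]} {x : ℂ}
    (hp : ∀ z, p.derivative.eval z = 0 → p.derivative.derivative.eval z ≠ 0)
    (hu : u.natDegree < p.derivative.natDegree) (hx : p.derivative.eval x ≠ 0) :
    u.eval x / p.derivative.eval x +
      ∑ c ∈ p.derivative.roots.toFinset,
        u.eval c / (p.derivative.derivative.eval c * (c - x)) = 0 := by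
  set q := p.derivative with hq
  have hq0 : q ≠ 0 := by rintro h; simp [h] at hu
  have hX : (X - C x : ℂ[X]) ≠ 0 := X_sub_C_ne_zero x
  have hne : ∀ c, q.eval c = 0 → c - x ≠ 0 := fun c hc h => hx (by rw [← sub_eq_zero.1 h, hc])
  have hmem : ∀ c, c ∈ q.roots.toFinset ↔ q.eval c = 0 := fun c => by simp [hq0]
  have key := sum_roots_eval_div_eval_derivative_eq_zero (F := (X - C x) * q) (u := u) ?_ ?_
  · rw [roots_mul (mul_ne_zero hX hq0), Multiset.toFinset_add, roots_X_sub_C,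
      Multiset.toFinset_singleton, Finset.sum_union, Finset.sum_singleton] at key
    · rw [← key]
      refine congrArg₂ (· + ·) ?_ ?_
      · simp
      · refine Finset.sum_congr rfl fun c hc => ?_
        rw [hmem] at hc
        simp [hc, mul_comm]
    · rw [Finset.disjoint_singleton_left, hmem]; exact hx
  · intro z hz
    rw [eval_mul, mul_eq_zero] at hz
    rcases hz with hz | hz
    · have : z = x := by simpa [sub_eq_zero] using hz
      subst this; simpa using hx
    · simpa [hz] using ⟨hne z hz, hp z hz⟩
  · rw [natDegree_mul hX hq0, natDegree_X_sub_C]; omega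

/-- The push-forward under `p` of the quadratic differential `dz² / (z - x)`. -/
theorem Polynomial.sum_fiber_inv {p : ℂ[X]} {x w : ℂ} (hdeg : 2 ≤ p.natDegree)
    (hp : ∀ z, p.derivative.eval z = 0 → p.derivative.derivative.eval z ≠ 0)
    (hx : p.derivative.eval x ≠ 0) (hxw : p.eval x ≠ w)
    (hw : ∀ c, p.derivative.eval c = 0 → p.eval c ≠ w) :
    ∑ z ∈ (p - C w).roots.toFinset, 1 / ((z - x) * p.derivative.eval z ^ 2) =
      1 / (p.derivative.eval x * (w - p.eval x)) +
      ∑ c ∈ p.derivative.roots.toFinset,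
        1 / (p.derivative.derivative.eval c * (c - x) * (w - p.eval c)) := by
  have hqd : p.derivative.natDegree = p.natDegree - 1 := natDegree_derivative p
  set q := p.derivative with hq
  have hq0 : q ≠ 0 := by rintro h; rw [h, natDegree_zero] at hqd; omega
  have hX : (X - C x : ℂ[X]) ≠ 0 := X_sub_C_ne_zero x
  have hrd : (p - C w).natDegree = p.natDegree := natDegree_sub_C
  have hr0 : p - C w ≠ 0 := by rintro h; rw [h, natDegree_zero] at hrd; omega
  have hne : ∀ c, q.eval c = 0 → c - x ≠ 0 := fun c hc h => hx (by rw [← sub_eq_zero.1 h, hc])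
  have hmem : ∀ c, c ∈ q.roots.toFinset ↔ q.eval c = 0 := fun c => by simp [hq0]
  have hmem' : ∀ c, c ∈ (p - C w).roots.toFinset ↔ p.eval c = w := fun c => by
    simp [hr0, sub_eq_zero]
  have hd : (p - C w).derivative = q := by simp [hq]
  -- Residues of 1/((z - x) p'(z) (p(z) - w)). On the fibre over `w` the factor p' appears twice,
  -- since it is also the derivative of p - w; this produces the square.
  have key := sum_roots_eval_div_eval_derivative_eq_zero
    (F := (X - C x) * (q * (p - C w))) (u := 1) ?_ ?_
  · rw [roots_mul (mul_ne_zero hX (mul_ne_zero hq0 hr0)), Multiset.toFinset_add, roots_X_sub_C,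
      Multiset.toFinset_singleton, Finset.sum_union, Finset.sum_singleton,
      roots_mul (mul_ne_zero hq0 hr0), Multiset.toFinset_add, Finset.sum_union] at key
    · have e1 : ∀ c ∈ q.roots.toFinset,
          eval c 1 / eval c (derivative ((X - C x) * (q * (p - C w)))) =
          - (1 / (q.derivative.eval c * (c - x) * (w - p.eval c))) := by
        intro c hc
        rw [hmem] at hc
        rw [← div_neg]
        simp only [derivative_mul, eval_add, eval_mul, hc, hd, eval_sub, eval_X, eval_C, eval_one]
        congr 1
        ring
      have e2 : ∀ c ∈ (p - C w).roots.toFinset,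
          eval c 1 / eval c (derivative ((X - C x) * (q * (p - C w)))) =
          1 / ((c - x) * q.eval c ^ 2) := by
        intro c hc
        rw [hmem'] at hc
        simp only [derivative_mul, eval_add, eval_mul, hc, hd, eval_sub, eval_X, eval_C, eval_one]
        congr 1
        ring
      rw [Finset.sum_congr rfl e1, Finset.sum_congr rfl e2, Finset.sum_neg_distrib] at key
      have e3 : eval x 1 / eval x (derivative ((X - C x) * (q * (p - C w)))) =
          - (1 / (q.eval x * (w - p.eval x))) := by
        rw [← div_neg]
        simp only [derivative_mul, eval_add, eval_mul, hd, eval_sub, eval_X, eval_C, eval_one,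
          derivative_sub, derivative_X, derivative_C, eval_zero]
        congr 1
        ring
      rw [e3] at key
      linear_combination key
    · rw [Finset.disjoint_left]
      intro c hc hc'
      exact hw c ((hmem c).1 hc) ((hmem' c).1 hc')
    · rw [Finset.disjoint_singleton_left, roots_mul (mul_ne_zero hq0 hr0), Multiset.toFinset_add,
        Finset.mem_union, hmem, hmem']
      simp [hx, hxw]
  · intro z hz
    simp only [eval_mul, mul_eq_zero, eval_sub, eval_X, eval_C, sub_eq_zero] at hz
    simp only [derivative_mul, eval_add, eval_mul, hd, eval_sub, eval_X, eval_C,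
          derivative_sub, derivative_X, derivative_C, eval_one, eval_zero]
    rcases hz with hz | hz | hz
    · subst hz
      simpa [sub_eq_zero] using ⟨hx, hxw⟩
    · simpa [hz, sub_eq_zero] using ⟨sub_ne_zero.1 (hne z hz), hp z hz, hw z hz⟩
    · have hqz : q.eval z ≠ 0 := fun h => hw z h hz
      have : z ≠ x := by rintro rfl; exact hxw hz
      simpa [hz, sub_eq_zero] using ⟨this, hqz⟩
  · rw [natDegree_mul hX (mul_ne_zero hq0 hr0), natDegree_mul hq0 hr0, natDegree_X_sub_C, hrd, hqd,
      natDegree_one]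
    omega

/-! ### Fibres, inverse branches and the area estimate -/

theorem Polynomial.card_fiber {p : ℂ[X]} {w : ℂ} (hd : 1 ≤ p.natDegree)
    (hw : ∀ z, p.eval z = w → p.derivative.eval z ≠ 0) :
    (p - C w).roots.toFinset.card = p.natDegree := by
  have hrd : (p - C w).natDegree = p.natDegree := natDegree_sub_C
  have hr0 : p - C w ≠ 0 := by rintro h; rw [h, natDegree_zero] at hrd; omega
  have hnodup : (p - C w).roots.Nodup := by
    rw [Multiset.nodup_iff_count_le_one]
    intro z
    rw [count_roots]
    by_contra! h
    have := (one_lt_rootMultiplicity_iff_isRoot hr0).1 h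
    refine hw z ?_ ?_
    · simpa [sub_eq_zero] using this.1
    · simpa using this.2
  rw [Multiset.toFinset_card_of_nodup hnodup, ← (IsAlgClosed.splits _).natDegree_eq_card_roots, hrd]

/-- Near a regular value `w₀`, the fibres of a polynomial are given by continuous inverse
branches. -/
theorem Polynomial.exists_inverse_branches {p : ℂ[X]} {w₀ : ℂ} (hd : 1 ≤ p.natDegree)
    (hw : ∀ z, p.eval z = w₀ → p.derivative.eval z ≠ 0) :
    ∃ (U : Set ℂ) (Z : Finset ℂ) (g : ℂ → ℂ → ℂ), IsOpen U ∧ w₀ ∈ U ∧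
      (∀ z ∈ Z, ContinuousOn (g z) U) ∧ (∀ z ∈ Z, ∀ w ∈ U, p.eval (g z w) = w) ∧
      (∀ w ∈ U, ∀ z, p.eval z = w → p.derivative.eval z ≠ 0) ∧
      (∀ w ∈ U, Set.InjOn (fun z => g z w) Z) ∧
      ∀ w ∈ U, (p - C w).roots.toFinset = Z.image (fun z => g z w) := by
  have hp0 : p.derivative ≠ 0 := by
    rintro h
    have := derivative_eq_zero.1 h
    omega
  have hr0 : ∀ w, p - C w ≠ 0 := fun w h => by
    have hrd : (p - C w).natDegree = p.natDegree := natDegree_sub_C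
    rw [h, natDegree_zero] at hrd; omega
  have hmem : ∀ w z, z ∈ (p - C w).roots.toFinset ↔ p.eval z = w := fun w z => by
    simp [hr0 w, sub_eq_zero]
  set Z := (p - C w₀).roots.toFinset with hZ
  have hex : ∀ z ∈ Z, ∃ e : OpenPartialHomeomorph ℂ ℂ, (∀ y, e y = p.eval y) ∧ z ∈ e.source := by
    intro z hz
    have h := (p.hasStrictDerivAt z).hasStrictFDerivAt_equiv (hw z ((hmem _ _).1 hz))
    exact ⟨h.toOpenPartialHomeomorph, fun y => by simp, h.mem_toOpenPartialHomeomorph_source⟩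
  have : Nonempty (OpenPartialHomeomorph ℂ ℂ) := ⟨OpenPartialHomeomorph.refl ℂ⟩
  choose! e he hes using hex
  have het : ∀ z ∈ Z, w₀ ∈ (e z).target := fun z hz => by
    have := (e z).map_source (hes z hz)
    rwa [he z hz, (hmem _ _).1 hz] at this
  have hg0 : ∀ z ∈ Z, (e z).symm w₀ = z := fun z hz => by
    have := (e z).left_inv (hes z hz)
    rwa [he z hz, (hmem _ _).1 hz] at this
  have hcont : ∀ z ∈ Z, ContinuousAt (e z).symm w₀ := fun z hz =>
    (e z).continuousAt_symm (het z hz)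
  have h1 : ∀ᶠ w in 𝓝 w₀, ∀ z ∈ Z, w ∈ (e z).target :=
    (Filter.eventually_all_finset Z).2 fun z hz => (e z).open_target.mem_nhds (het z hz)
  have h2 : ∀ᶠ w in 𝓝 w₀, ∀ z ∈ Z, ∀ z' ∈ Z, z ≠ z' → (e z).symm w ≠ (e z').symm w := by
    refine (Filter.eventually_all_finset Z).2 fun z hz =>
      (Filter.eventually_all_finset Z).2 fun z' hz' => ?_
    by_cases hzz : z = z'
    · exact Filter.Eventually.of_forall fun w h => (h hzz).elim
    · have hne : (e z).symm w₀ - (e z').symm w₀ ≠ 0 := by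
        rw [hg0 z hz, hg0 z' hz']
        exact sub_ne_zero.2 hzz
      filter_upwards [((hcont z hz).sub (hcont z' hz')).eventually_ne hne] with w hw' _ h
      exact hw' (sub_eq_zero.2 h)
  have h3 : ∀ᶠ w in 𝓝 w₀, ∀ z, p.eval z = w → p.derivative.eval z ≠ 0 := by
    have hfin : (p.eval '' {z | p.derivative.eval z = 0}).Finite := by
      refine Set.Finite.image _ ((p.derivative.roots.toFinset.finite_toSet).subset ?_)
      intro z hz
      simpa [hp0] using hz
    filter_upwards [hfin.isClosed.isOpen_compl.mem_nhds
      (show w₀ ∈ (p.eval '' {z | p.derivative.eval z = 0})ᶜ from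
        fun ⟨z, hz, hzw⟩ => hw z hzw hz)] with w hw' z hz h0
    exact hw' ⟨z, h0, hz⟩
  obtain ⟨U, hU, hUo, hwU⟩ := mem_nhds_iff.1 (h1.and (h2.and h3))
  have hright : ∀ z ∈ Z, ∀ w ∈ U, p.eval ((e z).symm w) = w := fun z hz w hwU => by
    have := (e z).right_inv ((hU hwU).1 z hz)
    rwa [he z hz] at this
  have hinj : ∀ w ∈ U, Set.InjOn (fun z => (e z).symm w) Z := fun w hwU z hz z' hz' h => by
    by_contra hne
    exact (hU hwU).2.1 z hz z' hz' hne h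
  refine ⟨U, Z, fun z => (e z).symm, hUo, hwU, fun z hz => (e z).continuousOn_symm.mono
    fun w hw' => (hU hw').1 z hz, hright, fun w hw' => (hU hw').2.2, hinj, fun w hw' => ?_⟩
  symm
  -- Regular fibres all have deg p points, so the distinct branch values exhaust the fibre.
  refine Finset.eq_of_subset_of_card_le ?_ ?_
  · intro y hy
    obtain ⟨z, hz, rfl⟩ := Finset.mem_image.1 hy
    exact (hmem _ _).2 (hright z hz w hw')
  · rw [Finset.card_image_of_injOn (hinj w hw'), card_fiber hd hw, card_fiber hd (hU hw').2.2]

/-- The real Jacobian of a holomorphic map is |g'|², the norm from ℂ to ℝ of multiplication by g'.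
-/
theorem Complex.lintegral_image_eq {g g' : ℂ → ℂ} {B : Set ℂ} (hB : MeasurableSet B)
    (hg : ∀ w ∈ B, HasDerivAt g (g' w) w) (hinj : Set.InjOn g B) (f : ℂ → ENNReal) :
    ∫⁻ z in g '' B, f z = ∫⁻ w in B, ‖g' w‖ₑ ^ 2 * f (g w) := by
  rw [lintegral_image_eq_lintegral_abs_det_fderiv_mul volume hB
    (fun w hw => ((hg w hw).hasFDerivAt.restrictScalars ℝ).hasFDerivWithinAt) hinj]
  refine lintegral_congr fun w => ?_
  congr 1
  have : ((ContinuousLinearMap.toSpanSingleton ℂ (g' w)).restrictScalars ℝ).det = ‖g' w‖ ^ 2 := by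
    simp [ContinuousLinearMap.det, LinearMap.det_restrictScalars,
      Algebra.norm_complex_eq, Complex.normSq_eq_norm_sq]
  rw [this, abs_of_nonneg (by positivity), ENNReal.ofReal_pow (norm_nonneg _), ofReal_norm]

/-- Quadratic differentials equal to their push-forward: the local area estimate. -/
theorem Polynomial.exists_nhds_lintegral_le_preimage {p : ℂ[X]} {w₀ : ℂ} (hd : 1 ≤ p.natDegree)
    (hw : ∀ z, p.eval z = w₀ → p.derivative.eval z ≠ 0) {r : ℂ → ℂ} (hr : Measurable r) :
    ∃ U : Set ℂ, IsOpen U ∧ w₀ ∈ U ∧ ∀ B ⊆ U, MeasurableSet B →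
      (∀ w ∈ B, r w = ∑ z ∈ (p - C w).roots.toFinset, r z / p.derivative.eval z ^ 2) →
      ∫⁻ w in B, ‖r w‖ₑ ≤ ∫⁻ z in p.eval ⁻¹' B, ‖r z‖ₑ := by
  obtain ⟨U, Z, g, hU, hwU, hgc, hpg, hreg, hinj, hfib⟩ := exists_inverse_branches hd hw
  refine ⟨U, hU, hwU, fun B hBU hB hrB => ?_⟩
  have hder : ∀ z ∈ Z, ∀ w ∈ B, HasDerivAt (g z) (p.derivative.eval (g z w))⁻¹ w :=
    fun z hz w hwB => HasDerivAt.of_local_left_inverse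
      ((hgc z hz).continuousAt (hU.mem_nhds (hBU hwB))) (p.hasDerivAt _)
      (hreg w (hBU hwB) _ (hpg z hz w (hBU hwB)))
      (by filter_upwards [hU.mem_nhds (hBU hwB)] with y hy using hpg z hz y hy)
  have hginj : ∀ z ∈ Z, Set.InjOn (g z) B := fun z hz w hw' w' hw'' h => by
    rw [← hpg z hz w (hBU hw'), h, hpg z hz w' (hBU hw'')]
  have hgm : ∀ z ∈ Z, MeasurableSet (g z '' B) := fun z hz =>
    measurable_image_of_fderivWithin hB
      (fun w hw => ((hder z hz w hw).hasFDerivAt.restrictScalars ℝ).hasFDerivWithinAt) (hginj z hz)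
  -- Triangle inequality on the fibre sum, then a change of variables along each branch: 1/|p'|² is
  -- the Jacobian of the branch, and the branch images are disjoint in the preimage of `B`.
  calc ∫⁻ w in B, ‖r w‖ₑ
      ≤ ∫⁻ w in B, ∑ z ∈ Z, ‖r (g z w) / p.derivative.eval (g z w) ^ 2‖ₑ := by
        refine setLIntegral_mono' hB fun w hwB => ?_
        rw [hrB w hwB, hfib w (hBU hwB), Finset.sum_image (hinj w (hBU hwB))]
        exact enorm_sum_le _ _
    _ = ∑ z ∈ Z, ∫⁻ w in B, ‖r (g z w) / p.derivative.eval (g z w) ^ 2‖ₑ := by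
        refine lintegral_finsetSum' _ fun z hz => ?_
        have h1 : AEMeasurable (g z) (volume.restrict B) :=
          ((hgc z hz).mono hBU).aemeasurable hB
        have h2 : Measurable fun y => ‖r y / p.derivative.eval y ^ 2‖ₑ :=
          (hr.div (p.derivative.continuous.measurable.pow_const 2)).enorm
        exact h2.comp_aemeasurable h1
    _ = ∑ z ∈ Z, ∫⁻ y in g z '' B, ‖r y‖ₑ := by
        refine Finset.sum_congr rfl fun z hz => ?_
        rw [Complex.lintegral_image_eq hB (hder z hz) (hginj z hz)]
        refine lintegral_congr fun w => ?_
        rw [div_eq_mul_inv, enorm_mul, mul_comm, ← inv_pow, enorm_pow]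
    _ = ∫⁻ y in ⋃ z ∈ Z, g z '' B, ‖r y‖ₑ := by
        rw [lintegral_biUnion_finset _ hgm]
        intro z hz z' hz' hne
        rw [Function.onFun, Set.disjoint_left]
        rintro _ ⟨w, hw', rfl⟩ ⟨w', hw'', h⟩
        have : w' = w := by
          rw [← hpg z' hz' w' (hBU hw''), h, hpg z hz w (hBU hw')]
        subst this
        exact hne (hinj w' (hBU hw') hz hz' h.symm)
    _ ≤ ∫⁻ z in p.eval ⁻¹' B, ‖r z‖ₑ := by
        refine lintegral_mono_set (Set.iUnion₂_subset fun z hz => ?_)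
        rintro _ ⟨w, hw', rfl⟩
        simpa [hpg z hz w (hBU hw')] using hw'

/-- By Lindelöf, countably many local neighbourhoods cover the complement of `S`. Cutting `B \ S`
into disjoint pieces inside them globalises the estimate, as the finite set `S` is null. -/
theorem Polynomial.lintegral_le_preimage {p : ℂ[X]} (hd : 1 ≤ p.natDegree) {r : ℂ → ℂ}
    (hr : Measurable r) {S : Set ℂ} (hS : S.Finite)
    (hcrit : ∀ z, p.derivative.eval z = 0 → p.eval z ∈ S)
    (hrS : ∀ w ∉ S, r w = ∑ z ∈ (p - C w).roots.toFinset, r z / p.derivative.eval z ^ 2)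
    {B : Set ℂ} (hB : MeasurableSet B) :
    ∫⁻ w in B, ‖r w‖ₑ ≤ ∫⁻ z in p.eval ⁻¹' B, ‖r z‖ₑ := by
  have hex : ∀ w ∈ Sᶜ, ∃ U : Set ℂ, IsOpen U ∧ w ∈ U ∧ ∀ B ⊆ U, MeasurableSet B →
      (∀ w ∈ B, r w = ∑ z ∈ (p - C w).roots.toFinset, r z / p.derivative.eval z ^ 2) →
      ∫⁻ w in B, ‖r w‖ₑ ≤ ∫⁻ z in p.eval ⁻¹' B, ‖r z‖ₑ := fun w hw =>
    exists_nhds_lintegral_le_preimage hd (fun z hz h0 => hw (by rw [← hz]; exact hcrit z h0)) hr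
  choose! U hUo hwU hUB using hex
  obtain ⟨T, hTS, hTc, hT⟩ := TopologicalSpace.countable_cover_nhdsWithin
    (s := Sᶜ) (f := U) fun w hw => mem_nhdsWithin_of_mem_nhds ((hUo w hw).mem_nhds (hwU w hw))
  have hTne : T.Nonempty := by
    obtain ⟨w, hw⟩ := hS.infinite_compl.nonempty
    obtain ⟨t, ht, -⟩ := Set.mem_iUnion₂.1 (hT hw)
    exact ⟨t, ht⟩
  obtain ⟨t, rfl⟩ := hTc.exists_eq_range hTne
  have htS : ∀ k, t k ∈ Sᶜ := fun k => hTS ⟨k, rfl⟩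
  set D := disjointed fun k => U (t k) with hD
  have hDm : ∀ k, MeasurableSet (D k) := MeasurableSet.disjointed fun k =>
    (hUo _ (htS k)).measurableSet
  have hDU : ∀ k, D k ⊆ U (t k) := disjointed_subset _
  have hDd : Pairwise (Function.onFun Disjoint D) := disjoint_disjointed _
  have hDS : Sᶜ ⊆ ⋃ k, D k := by
    rw [hD, iUnion_disjointed]
    simpa using hT
  have hSm : MeasurableSet S := hS.measurableSet
  set E : ℕ → Set ℂ := fun k => (B \ S) ∩ D k with hE
  have hEm : ∀ k, MeasurableSet (E k) := fun k => (hB.diff hSm).inter (hDm k)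
  have hEd : Pairwise (Function.onFun Disjoint E) := fun i j hij =>
    (hDd hij).mono Set.inter_subset_right Set.inter_subset_right
  have hEB : ⋃ k, E k = B \ S := by
    rw [hE, ← Set.inter_iUnion, Set.inter_eq_left]
    exact fun w hw => hDS hw.2
  calc ∫⁻ w in B, ‖r w‖ₑ = ∫⁻ w in B \ S, ‖r w‖ₑ :=
        setLIntegral_congr (sdiff_null_ae_eq_self (hS.measure_zero volume)).symm
    _ = ∑' k, ∫⁻ w in E k, ‖r w‖ₑ := by rw [← hEB, lintegral_iUnion hEm hEd]
    _ ≤ ∑' k, ∫⁻ z in p.eval ⁻¹' (E k), ‖r z‖ₑ :=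
        ENNReal.tsum_le_tsum fun k => hUB _ (htS k) _ (Set.inter_subset_right.trans (hDU k))
          (hEm k) fun w hw => hrS w hw.1.2
    _ = ∫⁻ z in ⋃ k, p.eval ⁻¹' (E k), ‖r z‖ₑ := by
        rw [lintegral_iUnion (fun k => p.continuous.measurable (hEm k))]
        exact fun i j hij => (hEd hij).preimage _
    _ ≤ ∫⁻ z in p.eval ⁻¹' B, ‖r z‖ₑ := by
        refine lintegral_mono_set ?_
        rw [← Set.preimage_iUnion, hEB]
        exact Set.preimage_mono Set.sdiff_subset

/-! ### Vanishing of invariant quadratic differentials -/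

theorem Complex.integrableOn_ball_inv_sub (y : ℂ) (R : ℝ) :
    IntegrableOn (fun w : ℂ => (w - y)⁻¹) (Metric.ball 0 R) := by
  have h0 : LocallyIntegrable (fun w : ℂ => w⁻¹) := by
    refine locallyIntegrable_of_norm_le_rpow (C := 1) (α := 1) (by simp) (by simp) ?_
      measurable_inv.aestronglyMeasurable
    refine Filter.Eventually.of_forall fun z => ?_
    rw [norm_inv, one_mul, Real.rpow_neg_one]
  have h1 : IntegrableOn (fun w : ℂ => w⁻¹) (Metric.ball (-y) R) :=
    (h0.integrableOn_isCompact (isCompact_closedBall _ _)).mono_set Metric.ball_subset_closedBall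
  have h2 := ((measurePreserving_sub_right (volume : Measure ℂ) y).integrableOn_comp_preimage
    (measurableEmbedding_subRight y)).2 h1
  have h3 : Metric.ball 0 R = (fun x => x - y) ⁻¹' Metric.ball (-y) R := by
    ext w
    simp
  rw [h3]
  exact h2

/-- In p(z) = z·s(z) + p(0) the quotient s is nonconstant, so |s| ≥ 3 far out and one |z| absorbs
p(0). It places the preimage of the disc of radius 2R inside the disc of radius R. -/
theorem Polynomial.exists_two_mul_norm_le {p : ℂ[X]} (hd : 2 ≤ p.natDegree) :
    ∃ R : ℝ, 0 < R ∧ ∀ z : ℂ, R ≤ ‖z‖ → 2 * ‖z‖ ≤ ‖p.eval z‖ := by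
  have hq : 0 < p.divX.degree := by
    rw [← natDegree_pos_iff_degree_pos, natDegree_divX_eq_natDegree_tsub_one]; omega
  have h1 := p.divX.tendsto_norm_atTop hq (tendsto_norm_cocompact_atTop (E := ℂ))
  have h2 := h1.eventually_ge_atTop 3
  rw [Filter.eventually_iff, Metric.mem_cocompact_iff_closedBall_compl_subset 0] at h2
  obtain ⟨R, hR⟩ := h2
  refine ⟨max (R + 1) (‖p.coeff 0‖ + 1), lt_max_of_lt_right (by positivity), fun z hz => ?_⟩
  have hz1 : 3 ≤ ‖p.divX.eval z‖ := hR (by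
    have := (le_max_left _ _).trans hz
    simp only [Set.mem_compl_iff, Metric.mem_closedBall, dist_zero_right, not_le]
    linarith)
  have hz2 : ‖p.coeff 0‖ + 1 ≤ ‖z‖ := (le_max_right _ _).trans hz
  have he : p.eval z = p.divX.eval z * z + p.coeff 0 := by
    conv_lhs => rw [← divX_mul_X_add p]
    simp
  have h3 : ‖p.divX.eval z * z‖ - ‖p.coeff 0‖ ≤ ‖p.eval z‖ := by
    rw [he]
    have := norm_sub_norm_le (p.divX.eval z * z) (-p.coeff 0)
    simpa using this
  rw [norm_mul] at h3
  nlinarith [norm_nonneg z]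

/-- Clearing denominators gives a polynomial with infinitely many roots; evaluating it at the node y
isolates `a y`. -/
theorem Finset.eq_zero_of_infinite_sum_div_sub_eq_zero {X : Finset ℂ} {a : ℂ → ℂ}
    (h : {w : ℂ | ∑ y ∈ X, a y / (w - y) = 0}.Infinite) : ∀ y ∈ X, a y = 0 := by
  set N : ℂ[X] := ∑ y ∈ X, C (a y) * ∏ x ∈ X.erase y, (Polynomial.X - C x) with hN
  have hN0 : N = 0 := by
    refine eq_zero_of_infinite_isRoot N ((h.sdiff X.finite_toSet).mono ?_)
    rintro w ⟨hw, hwX⟩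
    have hne : ∀ x ∈ X, w - x ≠ 0 := fun x hx h => hwX (by rw [sub_eq_zero.1 h]; exact hx)
    have : N.eval w = (∏ x ∈ X, (w - x)) * ∑ y ∈ X, a y / (w - y) := by
      rw [hN, eval_finsetSum, Finset.mul_sum]
      refine Finset.sum_congr rfl fun y hy => ?_
      rw [← Finset.mul_prod_erase X _ hy, eval_mul, eval_C, eval_prod]
      simp only [eval_sub, eval_X, eval_C]
      field_simp [hne y hy]
    rw [Set.mem_ofPred_eq] at hw ⊢
    rw [IsRoot, this, hw, mul_zero]
  intro y hy
  have h1 : N.eval y = 0 := by rw [hN0, eval_zero]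
  rw [hN, eval_finsetSum, Finset.sum_eq_single_of_mem y hy] at h1
  · rw [eval_mul, eval_C, eval_prod, mul_eq_zero] at h1
    refine h1.resolve_right (Finset.prod_ne_zero_iff.2 fun x hx => ?_)
    simpa [sub_eq_zero] using (Finset.ne_of_mem_erase hx).symm
  · intro b hb hby
    rw [eval_mul, eval_prod, Finset.prod_eq_zero (Finset.mem_erase.2 ⟨hby.symm, hy⟩) (by simp),
      mul_zero]

/-- A quadratic differential with simple poles which is equal to its push-forward under a
polynomial of degree at least two vanishes. -/
theorem Polynomial.eq_zero_of_eq_pushforward {p : ℂ[X]} (hd : 2 ≤ p.natDegree) {X : Finset ℂ}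
    {a : ℂ → ℂ} {S : Set ℂ} (hS : S.Finite) (hcrit : ∀ z, p.derivative.eval z = 0 → p.eval z ∈ S)
    (hr : ∀ w ∉ S, ∑ y ∈ X, a y / (w - y) =
      ∑ z ∈ (p - C w).roots.toFinset, (∑ y ∈ X, a y / (z - y)) / p.derivative.eval z ^ 2) :
    ∀ y ∈ X, a y = 0 := by
  set r : ℂ → ℂ := fun w => ∑ y ∈ X, a y / (w - y) with hrdef
  have hrm : Measurable r := by fun_prop
  obtain ⟨R, hR0, hR⟩ := exists_two_mul_norm_le hd
  set B := Metric.ball (0 : ℂ) R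
  set B' := Metric.ball (0 : ℂ) (2 * R)
  have hBB' : B ⊆ B' := Metric.ball_subset_ball (by linarith)
  have hpre : p.eval ⁻¹' B' ⊆ B := by
    intro z hz
    simp only [B, B', Set.mem_preimage, mem_ball_zero_iff] at hz ⊢
    by_contra! h
    linarith [hR z h]
  have hint : IntegrableOn r B := by
    refine integrable_finsetSum _ fun y _ => ?_
    simp only [div_eq_mul_inv]
    exact (Complex.integrableOn_ball_inv_sub y R).const_mul _
  have hle : ∫⁻ w in B', ‖r w‖ₑ ≤ ∫⁻ w in B, ‖r w‖ₑ :=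
    (lintegral_le_preimage (by omega) hrm hS hcrit hr Metric.isOpen_ball.measurableSet).trans
      (lintegral_mono_set hpre)
  -- Finiteness of the mass on `B` is essential here: it is cancelled from both sides, leaving no
  -- mass on the annulus.
  have hzero : ∫⁻ w in B' \ B, ‖r w‖ₑ = 0 := by
    have h1 := lintegral_inter_add_sdiff (μ := volume) (fun w => ‖r w‖ₑ) B'
      (Metric.isOpen_ball (x := (0 : ℂ)) (ε := R)).measurableSet
    rw [Set.inter_eq_right.2 hBB'] at h1
    rw [← h1] at hle
    have hfin : ∫⁻ w in B, ‖r w‖ₑ ≠ ⊤ := hint.hasFiniteIntegral.ne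
    by_contra hne
    exact absurd hle (not_le.2 (ENNReal.lt_add_right hfin hne))
  have hae : ∀ᵐ w ∂(volume.restrict (B' \ B)), r w = 0 := by
    have := (lintegral_eq_zero_iff hrm.enorm).1 hzero
    filter_upwards [this] with w hw
    simpa using hw
  refine Finset.eq_zero_of_infinite_sum_div_sub_eq_zero fun hfin => ?_
  -- The open annulus has positive area, so the zero set of `r` cannot be finite.
  have hopen : IsOpen (B' \ Metric.closedBall (0 : ℂ) R) :=
    Metric.isOpen_ball.sdiff Metric.isClosed_closedBall
  have hpos : 0 < volume (B' \ Metric.closedBall (0 : ℂ) R) := by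
    refine hopen.measure_pos _ ⟨((3 / 2 * R : ℝ) : ℂ), ?_⟩
    simp only [B', Set.mem_sdiff, mem_ball_zero_iff, mem_closedBall_zero_iff, Complex.norm_real,
      Real.norm_eq_abs]
    rw [abs_of_pos (by positivity)]
    constructor <;> linarith
  have hsub : volume (B' \ Metric.closedBall (0 : ℂ) R) ≤ volume {w | r w = 0} := by
    refine measure_mono_ae ?_
    have h2 := (ae_restrict_iff' (Metric.isOpen_ball.measurableSet.diff
      Metric.isOpen_ball.measurableSet)).1 hae
    filter_upwards [h2] with w hw hw'
    exact hw ⟨hw'.1, fun h => hw'.2 (Metric.ball_subset_closedBall h)⟩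
  rw [hfin.measure_zero] at hsub
  exact absurd hpos (not_lt.2 hsub)

/-! ### Duality and infinitesimal rigidity -/

/-- Injectivity of `1 - T`, where `T` is the transpose of the push-forward operator on
quadratic differentials with simple poles on `X`. -/
theorem Polynomial.eq_zero_of_fixed {p : ℂ[X]} (hd : 2 ≤ p.natDegree)
    (hp : ∀ z, p.derivative.eval z = 0 → p.derivative.derivative.eval z ≠ 0) {X : Finset ℂ}
    (hX : ∀ x ∈ X, p.eval x ∈ X) (hXc : ∀ c, p.derivative.eval c = 0 → p.eval c ∈ X)
    (hX' : ∀ x ∈ X, p.derivative.eval x ≠ 0) {ξ : ℂ → ℂ}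
    (hξ : ∀ x ∈ X, ξ x = ξ (p.eval x) / p.derivative.eval x +
      ∑ c ∈ p.derivative.roots.toFinset,
        ξ (p.eval c) / (p.derivative.derivative.eval c * (c - x))) :
    ∀ x ∈ X, ξ x = 0 := by
  have hq0 : p.derivative ≠ 0 := by
    intro h
    have := derivative_eq_zero.1 h
    omega
  set q := p.derivative with hq
  set K := q.roots.toFinset with hK
  have hKm : ∀ c ∈ K, q.eval c = 0 := fun c hc => by simpa [hK, hq0] using hc
  -- Entry (x, y) is the coefficient of 1/(w - y) in the push-forward of 1/(z - x), read off from
  -- `sum_fiber_inv`.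
  let M : Matrix X X ℂ := fun x y => (if p.eval (x : ℂ) = y then 1 / q.eval (x : ℂ) else 0) +
    ∑ c ∈ K, if p.eval c = y then 1 / (q.derivative.eval c * (c - x)) else 0
  have hM : ∀ (x : X) (f : ℂ → ℂ), ∑ y : X, M x y * f y = f (p.eval (x : ℂ)) / q.eval (x : ℂ) +
      ∑ c ∈ K, f (p.eval c) / (q.derivative.eval c * (c - x)) := by
    intro x f
    have hsum : ∀ z ∈ X, ∀ b : ℂ, ∑ y : X, (if z = (y : ℂ) then b else 0) * f y = b * f z := by
      intro z hz b
      rw [Finset.sum_eq_single (⟨z, hz⟩ : X)]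
      · simp
      · intro y _ hy
        rw [if_neg, zero_mul]
        rintro rfl; exact hy rfl
      · simp
    simp only [M, add_mul, Finset.sum_add_distrib, Finset.sum_mul]
    rw [Finset.sum_comm, hsum _ (hX x x.2)]
    congr 1
    · ring
    · refine Finset.sum_congr rfl fun c hc => ?_
      rw [hsum _ (hXc c (hKm c hc))]
      ring
  have hdet : (1 - M).det ≠ 0 := by
    intro h0
    -- A left null vector `v` of 1 - M gives an invariant differential with residues `v y`, whereas
    -- `ξ` is a right null vector; the determinant links the two.
    obtain ⟨v, hv0, hv⟩ := Matrix.exists_vecMul_eq_zero_iff.2 h0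
    rw [Matrix.vecMul_sub, Matrix.vecMul_one, sub_eq_zero] at hv
    apply hv0
    let a : ℂ → ℂ := fun y => if h : y ∈ X then v ⟨y, h⟩ else 0
    have ha : ∀ y : X, a y = v y := fun y => by simp [a]
    have hsumX : ∀ g : ℂ → ℂ, ∑ y ∈ X, g y = ∑ y : X, g y := fun g =>
      (Finset.sum_coe_sort X g).symm
    have := eq_zero_of_eq_pushforward hd (X := X) (a := a) (S := X) X.finite_toSet
      (fun c hc => hXc c hc) ?_
    · ext y
      rw [← ha]; exact this y y.2
    · intro w hw
      have hne : ∀ x : X, p.eval (x : ℂ) ≠ w := fun x h => hw (by rw [← h]; exact hX x x.2)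
      have hcw : ∀ c, q.eval c = 0 → p.eval c ≠ w := fun c hc h => hw (by
        rw [← h]; exact hXc c hc)
      calc ∑ y ∈ X, a y / (w - y) = ∑ y : X, v y * (1 / (w - y)) := by
            rw [hsumX]
            refine Finset.sum_congr rfl fun y _ => ?_
            rw [ha, mul_one_div]
        _ = ∑ y : X, ∑ x : X, v x * (M x y * (1 / (w - y))) := by
            refine Finset.sum_congr rfl fun y _ => ?_
            conv_lhs => rw [hv]
            rw [Matrix.vecMul, dotProduct, Finset.sum_mul]
            exact Finset.sum_congr rfl fun x _ => by ring
        _ = ∑ x : X, v x * ∑ z ∈ (p - C w).roots.toFinset, 1 / ((z - x) * q.eval z ^ 2) := by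
            rw [Finset.sum_comm]
            refine Finset.sum_congr rfl fun x _ => ?_
            rw [← Finset.mul_sum, hM x fun y => 1 / (w - y),
              sum_fiber_inv hd hp (hX' x x.2) (hne x) hcw]
            congr 2
            · rw [div_div, mul_comm]
            · exact Finset.sum_congr rfl fun c _ => by rw [div_div, mul_comm]
        _ = _ := by
            simp only [Finset.mul_sum, Finset.sum_div]
            rw [Finset.sum_comm]
            refine Finset.sum_congr rfl fun z _ => ?_
            rw [hsumX]
            refine Finset.sum_congr rfl fun x _ => ?_
            rw [ha, mul_one_div, div_div]
  have hfix : (1 - M).mulVec (fun x : X => ξ x) = 0 := by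
    rw [Matrix.sub_mulVec, Matrix.one_mulVec, sub_eq_zero]
    ext x
    rw [Matrix.mulVec, dotProduct, hM x ξ]
    exact hξ x x.2
  have hzero := Matrix.eq_zero_of_mulVec_eq_zero hdet hfix
  intro x hx
  exact congrFun hzero ⟨x, hx⟩

/-- Along an orbit which is eventually periodic with exact data `(n, m)`, a sequence that is
determined by a recursion over the orbit and closes up at `m` only depends on the orbit point. -/
theorem Function.eq_of_iterate_eq_of_recursion {α β : Type*} {f : α → α} {x : α} {n m : ℕ}
    (hnm : n < m) (hper : ∀ k, f^[k] x ∈ Function.periodicPts f ↔ n ≤ k)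
    (hperiod : ∀ k, n ≤ k → Function.minimalPeriod f (f^[k] x) = m - n)
    {G : α → β → β} {ζ : ℕ → β} (hζ : ∀ k, ζ (k + 1) = G (f^[k] x) (ζ k)) (hclose : ζ m = ζ n)
    {k l : ℕ} (hkl : f^[k] x = f^[l] x) : ζ k = ζ l := by
  have hx : f^[m] x = f^[n] x := by
    have h1 := Function.iterate_minimalPeriod (f := f) (x := f^[n] x)
    rw [hperiod n le_rfl, ← Function.iterate_add_apply] at h1
    rwa [Nat.sub_add_cancel hnm.le] at h1
  have hshift : ∀ j, ζ (m + j) = ζ (n + j) ∧ f^[m + j] x = f^[n + j] x := by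
    intro j
    induction j with
    | zero => exact ⟨hclose, hx⟩
    | succ j ih =>
      refine ⟨?_, ?_⟩
      · rw [← add_assoc, ← add_assoc, hζ, hζ, ih.1, ih.2]
      · rw [← add_assoc, ← add_assoc, Function.iterate_succ_apply', Function.iterate_succ_apply',
          ih.2]
  have hmul : ∀ k, n ≤ k → ∀ j, ζ (k + j * (m - n)) = ζ k := by
    intro k hk j
    induction j with
    | zero => simp
    | succ j ih =>
      have := (hshift (k + j * (m - n) - n)).1
      rw [show m + (k + j * (m - n) - n) = k + (j + 1) * (m - n) by
        rw [add_mul, one_mul]; omega, show n + (k + j * (m - n) - n) = k + j * (m - n) by omega]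
        at this
      rw [this, ih]
  have hlt : ∀ k l, k < l → f^[k] x = f^[l] x → ζ k = ζ l := by
    intro k l hlt hkl
    have hp : Function.IsPeriodicPt f (l - k) (f^[k] x) := by
      rw [Function.IsPeriodicPt, Function.IsFixedPt, ← Function.iterate_add_apply,
        Nat.sub_add_cancel hlt.le, hkl]
    -- A repeated point is periodic, so `k` is past the preperiod and the exact period m - n divides
    -- l - k.
    have hk : n ≤ k := (hper k).1 ⟨l - k, by omega, hp⟩
    have hdvd := hp.minimalPeriod_dvd
    rw [hperiod k hk] at hdvd
    obtain ⟨j, hj⟩ := hdvd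
    rw [← hmul k hk j, mul_comm, ← hj]
    congr 1; omega
  rcases lt_trichotomy k l with h | h | h
  · exact hlt k l h hkl
  · rw [h]
  · exact (hlt l k h hkl.symm).symm

/-- Infinitesimal rigidity of strictly postcritically finite polynomials with simple critical
points, on the slice of perturbations of degree at most `d - 2`. -/
theorem Polynomial.eq_zero_of_critical_relations_preserved {p u : ℂ[X]} (hd : 2 ≤ p.natDegree)
    (hp : ∀ z, p.derivative.eval z = 0 → p.derivative.derivative.eval z ≠ 0)
    {ι : Type*} [Finite ι] {c : ι → ℂ} (hcinj : Function.Injective c)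
    (hc : ∀ z, p.derivative.eval z = 0 ↔ ∃ i, c i = z)
    (hfin : ∀ i, (Set.range fun k : ℕ => (p.eval)^[k] (c i)).Finite)
    (hdisj : ∀ i j, c i ≠ c j → ∀ k l : ℕ, (p.eval)^[k] (c i) ≠ (p.eval)^[l] (c j))
    {m n : ι → ℕ} (hn : ∀ i, 1 ≤ n i) (hmn : ∀ i, n i < m i)
    (hper : ∀ i, ∀ k : ℕ, (p.eval)^[k] (c i) ∈ Function.periodicPts p.eval ↔ n i ≤ k)
    (hperiod : ∀ i, ∀ k : ℕ, n i ≤ k →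
      Function.minimalPeriod p.eval ((p.eval)^[k] (c i)) = m i - n i)
    (hu : u.natDegree < p.derivative.natDegree) {ζ : ι → ℕ → ℂ}
    (hζ : ∀ i k, ζ i (k + 1) = u.eval ((p.eval)^[k] (c i)) +
      p.derivative.eval ((p.eval)^[k] (c i)) * ζ i k)
    (hclose : ∀ i, ζ i (m i) = ζ i (n i)) : u = 0 := by
  classical
  have hq0 : p.derivative ≠ 0 := by rintro h; simp [h] at hu
  have hij : ∀ i j k l, (p.eval)^[k] (c i) = (p.eval)^[l] (c j) → i = j := by
    intro i j k l h
    by_contra hne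
    exact hdisj i j (fun h' => hne (hcinj h')) k l h
  have hcp : ∀ i, c i ∉ Function.periodicPts p.eval := by
    intro i h
    have h1 := (hper i 0).1 h
    have h2 := hn i
    omega
  have hnc : ∀ i k, p.derivative.eval ((p.eval)^[k + 1] (c i)) ≠ 0 := by
    intro i k h
    obtain ⟨j, hj⟩ := (hc _).1 h
    have := hij j i 0 (k + 1) hj
    subst this
    exact hcp j ⟨k + 1, by omega, hj.symm⟩
  have hXfin : (⋃ i, Set.range fun k : ℕ => (p.eval)^[k + 1] (c i)).Finite := by
    refine Set.finite_iUnion fun i => (hfin i).subset ?_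
    rintro _ ⟨k, rfl⟩
    exact ⟨k + 1, rfl⟩
  -- Orbits start at time 1: this leaves out the critical points, so p' does not vanish on `X`.
  set X := hXfin.toFinset with hX
  have hXm : ∀ x, x ∈ X ↔ ∃ i k, (p.eval)^[k + 1] (c i) = x := by
    intro x; simp [hX]
  let orb : ι × ℕ → ℂ := fun a => (p.eval)^[a.2] (c a.1)
  have hfac : Function.FactorsThrough (fun a : ι × ℕ => ζ a.1 a.2) orb := by
    rintro ⟨i, k⟩ ⟨j, l⟩ h
    have := hij i j k l h
    subst this
    exact Function.eq_of_iterate_eq_of_recursion (hmn i) (hper i) (hperiod i)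
      (G := fun x y => u.eval x + p.derivative.eval x * y) (hζ i) (hclose i) h
  set ξ : ℂ → ℂ := Function.extend orb (fun a : ι × ℕ => ζ a.1 a.2) 0 with hξdef
  have hξ : ∀ i k, ξ ((p.eval)^[k] (c i)) = ζ i k := fun i k => hfac.extend_apply 0 (i, k)
  have hξc : ∀ i, ξ (p.eval (c i)) = u.eval (c i) := by
    intro i
    have h1 := hξ i 1
    have h2 := hζ i 0
    have h3 : p.derivative.eval (c i) = 0 := (hc _).2 ⟨i, rfl⟩
    simp only [Function.iterate_one, Function.iterate_zero, id] at h1 h2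
    rw [h1, h2, h3, zero_mul, add_zero]
  have hzero := eq_zero_of_fixed hd hp (X := X) (ξ := ξ) ?_ ?_ ?_ ?_
  · have hcard : u.degree < (p.derivative.roots.toFinset).card := by
      have h1 := card_fiber (p := p.derivative) (w := 0) (by omega) hp
      rw [C_0, sub_zero] at h1
      rw [h1]
      exact degree_le_natDegree.trans_lt (by exact_mod_cast hu)
    refine eq_zero_of_degree_lt_of_eval_finset_eq_zero _ hcard fun z hz => ?_
    obtain ⟨i, rfl⟩ := (hc z).1 (by simpa [hq0] using hz)
    rw [← hξc]
    exact hzero _ ((hXm _).2 ⟨i, 0, rfl⟩)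
  · intro x hx
    obtain ⟨i, k, rfl⟩ := (hXm x).1 hx
    exact (hXm _).2 ⟨i, k + 1, Function.iterate_succ_apply' _ _ _⟩
  · intro z hz
    obtain ⟨i, rfl⟩ := (hc z).1 hz
    exact (hXm _).2 ⟨i, 0, rfl⟩
  · intro x hx
    obtain ⟨i, k, rfl⟩ := (hXm x).1 hx
    exact hnc i k
  · intro x hx
    obtain ⟨i, k, rfl⟩ := (hXm x).1 hx
    have h0 := hnc i k
    have h1 : p.eval ((p.eval)^[k + 1] (c i)) = (p.eval)^[k + 1 + 1] (c i) :=
      (Function.iterate_succ_apply' p.eval _ _).symm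
    rw [h1, hξ, hξ, hζ i (k + 1)]
    -- Since u(c) = ξ(p(c)), partial fractions replace u(x)/p'(x) by the critical sum; this uses deg
    -- u < deg p'.
    have h2 := sum_critical_eval_div hp hu h0
    have h3 : ∑ c' ∈ p.derivative.roots.toFinset, ξ (p.eval c') /
        (p.derivative.derivative.eval c' * (c' - (p.eval)^[k + 1] (c i))) =
        ∑ c' ∈ p.derivative.roots.toFinset, u.eval c' /
        (p.derivative.derivative.eval c' * (c' - (p.eval)^[k + 1] (c i))) := by
      refine Finset.sum_congr rfl fun z hz => ?_
      obtain ⟨j, rfl⟩ := (hc z).1 (by simpa [hq0] using hz)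
      rw [hξc]
    rw [h3, add_div, mul_div_cancel_left₀ _ h0]
    linear_combination -h2

/-! ### Calculus on the coefficient space -/

namespace PolyFamily

variable {d : ℕ}

theorem toPoly_eq_sum (b : Coeffs d) : toPoly b = ∑ i : Fin (d + 1), b i • (X : ℂ[X]) ^ (i : ℕ) := by
  simp only [toPoly, ← C_mul_X_pow_eq_monomial, smul_eq_C_mul]

theorem coeff_toPoly (b : Coeffs d) (k : ℕ) :
    (toPoly b).coeff k = if h : k < d + 1 then b ⟨k, h⟩ else 0 := by
  simp only [toPoly, finsetSum_coeff, coeff_monomial]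
  split_ifs with h
  · rw [Finset.sum_eq_single (⟨k, h⟩ : Fin (d + 1))]
    · simp
    · intro j _ hj
      rw [if_neg]
      rintro rfl; exact hj rfl
    · simp
  · refine Finset.sum_eq_zero fun j _ => if_neg ?_
    have := j.2
    omega

theorem coeff_toPoly_fin (b : Coeffs d) (i : Fin (d + 1)) : (toPoly b).coeff i = b i := by
  rw [coeff_toPoly, dif_pos i.2]

theorem natDegree_toPoly_le (b : Coeffs d) : (toPoly b).natDegree ≤ d := by
  rw [natDegree_le_iff_coeff_eq_zero]
  intro k hk
  rw [coeff_toPoly, dif_neg (by omega)]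

theorem natDegree_toPoly {b : Coeffs d} (hb : b ∈ polyDeg d) : (toPoly b).natDegree = d := by
  refine le_antisymm (natDegree_toPoly_le b) (le_natDegree_of_ne_zero ?_)
  rw [show (toPoly b).coeff d = b (Fin.last d) from coeff_toPoly_fin b (Fin.last d)]
  exact hb

theorem toPoly_coeff {q : ℂ[X]} (hq : q.natDegree ≤ d) :
    toPoly (fun i : Fin (d + 1) => q.coeff i) = q := by
  ext k
  rw [coeff_toPoly]
  split_ifs with h
  · rfl
  · exact (coeff_eq_zero_of_natDegree_lt (by omega)).symm

theorem toPoly_injective : Function.Injective (toPoly (d := d)) := fun a b h => by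
  ext i
  rw [← coeff_toPoly_fin a, h, coeff_toPoly_fin]

theorem toPoly_sub (a b : Coeffs d) : toPoly (a - b) = toPoly a - toPoly b := by
  simp [toPoly_eq_sum, sub_smul, Finset.sum_sub_distrib]

/-- The functional `b ↦ (D b)(z)` on coefficient vectors, where `D` is a linear operator on
polynomials. -/
noncomputable def evalFunctional (D : ℂ[X] →ₗ[ℂ] ℂ[X]) (z : ℂ) : Coeffs d →L[ℂ] ℂ :=
  ∑ i : Fin (d + 1), (D (X ^ (i : ℕ))).eval z • ContinuousLinearMap.proj i

theorem eval_map_toPoly (D : ℂ[X] →ₗ[ℂ] ℂ[X]) (b : Coeffs d) (z : ℂ) :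
    (D (toPoly b)).eval z = ∑ i : Fin (d + 1), b i * (D (X ^ (i : ℕ))).eval z := by
  simp [toPoly_eq_sum, eval_finsetSum]

theorem evalFunctional_apply (D : ℂ[X] →ₗ[ℂ] ℂ[X]) (z : ℂ) (b : Coeffs d) :
    evalFunctional D z b = (D (toPoly b)).eval z := by
  simp [evalFunctional, eval_map_toPoly, mul_comm]

theorem continuous_evalFunctional (D : ℂ[X] →ₗ[ℂ] ℂ[X]) :
    Continuous (fun z => evalFunctional (d := d) D z) :=
  continuous_finsetSum _ fun i _ => ((D (X ^ (i : ℕ))).continuous).smul continuous_const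

/-- The two terms come from varying the coefficients and from moving the point. Taking `D` to be the
identity, the derivative or its square covers Q, Q' and Q'' at once. -/
theorem hasFDerivAt_eval_map (D : ℂ[X] →ₗ[ℂ] ℂ[X]) {g : Coeffs d → ℂ} {g' : Coeffs d →L[ℂ] ℂ}
    {Q : Coeffs d} (hg : HasFDerivAt g g' Q) :
    HasFDerivAt (fun Q => (D (toPoly Q)).eval (g Q))
      (evalFunctional D (g Q) + (D (toPoly Q)).derivative.eval (g Q) • g') Q := by
  simp only [eval_map_toPoly]
  have h1 : ∀ i : Fin (d + 1), HasFDerivAt (fun Q : Coeffs d => Q i * (D (X ^ (i : ℕ))).eval (g Q))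
      (Q i • ((D (X ^ (i : ℕ))).derivative.eval (g Q) • g') +
        (D (X ^ (i : ℕ))).eval (g Q) • ContinuousLinearMap.proj i) Q := fun i =>
    ((ContinuousLinearMap.proj (R := ℂ) (φ := fun _ : Fin (d + 1) => ℂ) i).hasFDerivAt).mul
      (((D (X ^ (i : ℕ))).hasDerivAt (g Q)).comp_hasFDerivAt Q hg)
  have h2 := HasFDerivAt.fun_sum (u := Finset.univ) fun i _ => h1 i
  refine h2.congr_fderiv ?_
  rw [Finset.sum_add_distrib]
  refine (add_comm _ _).trans (congrArg₂ (· + ·) rfl ?_)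
  have : (D (toPoly Q)).derivative.eval (g Q) =
      ∑ i : Fin (d + 1), Q i * (D (X ^ (i : ℕ))).derivative.eval (g Q) :=
    eval_map_toPoly (Polynomial.derivative ∘ₗ D) Q (g Q)
  rw [this]
  refine ContinuousLinearMap.ext fun v => ?_
  simp [Finset.sum_mul, mul_assoc]

theorem contDiffAt_eval_map (D : ℂ[X] →ₗ[ℂ] ℂ[X]) {g : Coeffs d → ℂ} {Q : Coeffs d} {k : WithTop ℕ∞}
    (hg : ContDiffAt ℂ k g Q) : ContDiffAt ℂ k (fun Q => (D (toPoly Q)).eval (g Q)) Q := by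
  simp only [eval_map_toPoly]
  refine ContDiffAt.sum fun i _ => ContDiffAt.mul (by fun_prop) ?_
  have h := ((D (X ^ (i : ℕ))).contDiff_aeval (𝕜 := ℂ) (n := k) : ContDiff ℂ k _)
  simp only [coe_aeval_eq_eval] at h
  exact h.contDiffAt.comp Q hg

/-- A holomorphically moving simple critical point is continuously differentiable. -/
theorem contDiffAt_criticalPoint {V : Set (Coeffs d)} (hV : IsOpen V) {c : Coeffs d → ℂ}
    (hc : DifferentiableOn ℂ c V) (hcrit : ∀ Q ∈ V, (toPoly Q).derivative.eval (c Q) = 0)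
    {P : Coeffs d} (hP : P ∈ V) (hsimple : (toPoly P).derivative.derivative.eval (c P) ≠ 0) :
    ContDiffAt ℂ 1 c P := by
  have hcd : ∀ Q ∈ V, DifferentiableAt ℂ c Q := fun Q hQ => (hc Q hQ).differentiableAt (hV.mem_nhds hQ)
  have hcont : ContinuousOn (fun Q => (toPoly Q).derivative.derivative.eval (c Q)) V := fun Q hQ =>
    (hasFDerivAt_eval_map (Polynomial.derivative ∘ₗ Polynomial.derivative)
      (hcd Q hQ).hasFDerivAt).continuousAt.continuousWithinAt
  rw [contDiffAt_one_iff]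
  -- Candidate derivative from differentiating Q'(c(Q)) = 0 implicitly; its continuity is visible
  -- from the formula.
  refine ⟨fun Q => -((toPoly Q).derivative.derivative.eval (c Q))⁻¹ •
    evalFunctional Polynomial.derivative (c Q),
    V ∩ {Q | (toPoly Q).derivative.derivative.eval (c Q) ≠ 0}, ?_, ?_, ?_⟩
  · filter_upwards [hV.mem_nhds hP,
      (hcont.continuousAt (hV.mem_nhds hP)).eventually_ne hsimple] with Q h1 h2 using ⟨h1, h2⟩
  · have h1 : ContinuousOn (fun Q => -((toPoly Q).derivative.derivative.eval (c Q))⁻¹)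
        (V ∩ {Q | (toPoly Q).derivative.derivative.eval (c Q) ≠ 0}) :=
      ((hcont.mono Set.inter_subset_left).inv₀ fun Q hQ => hQ.2).neg
    exact h1.smul ((continuous_evalFunctional _).comp_continuousOn
      (hc.continuousOn.mono Set.inter_subset_left))
  · rintro Q ⟨hQ, hQ'⟩
    have h1 := hasFDerivAt_eval_map Polynomial.derivative (hcd Q hQ).hasFDerivAt
    have h2 : HasFDerivAt (fun Q => (Polynomial.derivative (toPoly Q)).eval (c Q))
        (0 : Coeffs d →L[ℂ] ℂ) Q := by
      refine (hasFDerivAt_const (0 : ℂ) Q).congr_of_eventuallyEq ?_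
      filter_upwards [hV.mem_nhds hQ] with R hR using hcrit R hR
    have h3 := h1.unique h2
    have hne : (toPoly Q).derivative.derivative.eval (c Q) ≠ 0 := hQ'
    refine (hcd Q hQ).hasFDerivAt.congr_fderiv (ContinuousLinearMap.ext fun v => ?_)
    have h4 := DFunLike.congr_fun h3 v
    simp only [_root_.add_apply, _root_.smul_apply, smul_eq_mul,
      _root_.zero_apply] at h4 ⊢
    field_simp
    linear_combination h4

theorem differentiableAt_iterate {c : Coeffs d → ℂ} {Q : Coeffs d} (hc : DifferentiableAt ℂ c Q)
    (k : ℕ) : DifferentiableAt ℂ (fun Q => (polyMap Q)^[k] (c Q)) Q := by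
  induction k with
  | zero => exact hc
  | succ k ih =>
    simp only [Function.iterate_succ_apply']
    exact (hasFDerivAt_eval_map LinearMap.id ih.hasFDerivAt).differentiableAt

theorem contDiffAt_iterate {c : Coeffs d → ℂ} {Q : Coeffs d} {n : WithTop ℕ∞}
    (hc : ContDiffAt ℂ n c Q) (k : ℕ) :
    ContDiffAt ℂ n (fun Q => (polyMap Q)^[k] (c Q)) Q := by
  induction k with
  | zero => exact hc
  | succ k ih =>
    simp only [Function.iterate_succ_apply']
    exact contDiffAt_eval_map LinearMap.id ih

/-- The velocity of the critical orbit satisfies the variational recursion. -/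
theorem fderiv_iterate_succ {c : Coeffs d → ℂ} {Q : Coeffs d} (hc : DifferentiableAt ℂ c Q)
    (k : ℕ) (v : Coeffs d) :
    fderiv ℂ (fun Q => (polyMap Q)^[k + 1] (c Q)) Q v =
      (toPoly v).eval ((polyMap Q)^[k] (c Q)) +
      (toPoly Q).derivative.eval ((polyMap Q)^[k] (c Q)) *
        fderiv ℂ (fun Q => (polyMap Q)^[k] (c Q)) Q v := by
  simp only [Function.iterate_succ_apply']
  have h := (hasFDerivAt_eval_map LinearMap.id
    (differentiableAt_iterate hc k).hasFDerivAt).fderiv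
  change fderiv ℂ (fun Q => (LinearMap.id (R := ℂ) (toPoly Q)).eval ((polyMap Q)^[k] (c Q))) Q v = _
  rw [h]
  simp [evalFunctional_apply]

/-! ### Tangent spaces of level sets -/

section Tangent

variable {E : Type*} [NormedAddCommGroup E] [NormedSpace ℂ E]

/-- Chain rule along a disc on which `F` vanishes. No regularity of `S` enters, so it serves both
hypersurfaces and the conjugacy class. -/
theorem fderiv_eq_zero_of_mem_tangentVectors {S : Set E} {x v : E} {F : E → ℂ}
    (hF : DifferentiableAt ℂ F x) (hv : v ∈ tangentVectors S x)
    (h : ∀ φ : ℂ → E, ContinuousAt φ 0 → φ 0 = x → (∀ᶠ t in 𝓝 (0 : ℂ), φ t ∈ S) →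
      ∀ᶠ t in 𝓝 (0 : ℂ), F (φ t) = 0) : fderiv ℂ F x v = 0 := by
  obtain ⟨φ, hφ, hφ0, hφS, rfl⟩ := hv
  subst hφ0
  have h1 : HasDerivAt (F ∘ φ) (fderiv ℂ F (φ 0) (deriv φ 0)) 0 :=
    hF.hasFDerivAt.comp_hasDerivAt 0 hφ.differentiableAt.hasDerivAt
  have h2 : HasDerivAt (F ∘ φ) 0 0 :=
    (hasDerivAt_const (0 : ℂ) (0 : ℂ)).congr_of_eventuallyEq (h φ hφ.continuousAt rfl hφS)
  exact h1.unique h2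

/-- The tangent space of a level set at a regular point is the kernel of the differential. -/
theorem tangentSpaceAt_eq_ker [CompleteSpace E] {F : E → ℂ} {x : E}
    (hF : ContDiffAt ℂ 1 F x) (hx : F x = 0) (hF' : fderiv ℂ F x ≠ 0) {H : Set E}
    (hH : ∀ᶠ y in 𝓝 x, y ∈ H ↔ F y = 0) :
    tangentSpaceAt H x = LinearMap.ker (fderiv ℂ F x : E →ₗ[ℂ] ℂ) := by
  have hFd : DifferentiableAt ℂ F x := hF.differentiableAt one_ne_zero
  refine le_antisymm (Submodule.span_le.2 fun v hv => ?_) fun v hv => Submodule.subset_span ?_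
  · refine fderiv_eq_zero_of_mem_tangentVectors hFd hv fun φ hφ hφ0 hφH => ?_
    subst hφ0
    filter_upwards [hφH, hφ.eventually hH] with t h1 h2 using h2.1 h1
  · have hv0 : fderiv ℂ F x v = 0 := hv
    obtain ⟨w, hw⟩ : ∃ w, fderiv ℂ F x w = 1 := by
      obtain ⟨w, hw⟩ : ∃ w, fderiv ℂ F x w ≠ 0 := by
        by_contra! h
        exact hF' (ContinuousLinearMap.ext h)
      exact ⟨(fderiv ℂ F x w)⁻¹ • w, by simp [hw]⟩
    -- On the slice x + s v + t w the map (s, t) ↦ (s, F) has identity differential at 0; the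
    -- required disc is the image of (t, 0) under its local inverse.
    let A : ℂ × ℂ → E := fun y => x + (y.1 • v + y.2 • w)
    have hA0 : A 0 = x := by simp [A]
    have hAc : ContDiff ℂ 1 A := by fun_prop
    let Ψ : ℂ × ℂ → ℂ × ℂ := fun y => (y.1, F (A y))
    have hΨ0 : Ψ 0 = 0 := by simp [Ψ, hA0, hx]
    have hΨc : ContDiffAt ℂ 1 Ψ 0 := by
      refine contDiffAt_fst.prodMk (ContDiffAt.comp 0 ?_ hAc.contDiffAt)
      rwa [hA0]
    let A' : ℂ × ℂ →L[ℂ] E := (ContinuousLinearMap.fst ℂ ℂ ℂ).smulRight v +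
        (ContinuousLinearMap.snd ℂ ℂ ℂ).smulRight w
    have hAd : HasFDerivAt A A' 0 :=
      ((hasFDerivAt_fst.smul_const v).add (hasFDerivAt_snd.smul_const w)).const_add x
    have hΨd : HasFDerivAt Ψ (ContinuousLinearEquiv.refl ℂ (ℂ × ℂ) : ℂ × ℂ →L[ℂ] ℂ × ℂ) 0 := by
      have h1 : HasFDerivAt F (fderiv ℂ F x) (A 0) := by rw [hA0]; exact hFd.hasFDerivAt
      refine (hasFDerivAt_fst.prodMk (h1.comp 0 hAd)).congr_fderiv ?_
      refine ContinuousLinearMap.ext fun y => ?_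
      simp [A', hv0, hw]
    have hs := hΨc.hasStrictFDerivAt' hΨd one_ne_zero
    have hgc : ContDiffAt ℂ 1 (hΨc.localInverse hΨd one_ne_zero) (Ψ 0) :=
      hΨc.to_localInverse hΨd one_ne_zero
    set g := hΨc.localInverse hΨd one_ne_zero with hg
    rw [hΨ0] at hgc
    have hgd : HasFDerivAt g
        ((ContinuousLinearEquiv.refl ℂ (ℂ × ℂ)).symm : ℂ × ℂ →L[ℂ] ℂ × ℂ) 0 := by
      have := hs.to_localInverse.hasFDerivAt
      rwa [hΨ0] at this
    have hgr : ∀ᶠ y in 𝓝 (0 : ℂ × ℂ), Ψ (g y) = y := by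
      have := hs.eventually_right_inverse
      rwa [hΨ0] at this
    have hg0 : g 0 = 0 := by
      have := hs.localInverse_apply_image
      rwa [hΨ0] at this
    let j : ℂ → ℂ × ℂ := fun t => (t, 0)
    have hj0 : j 0 = 0 := rfl
    have hjc : ContDiff ℂ 1 j := by fun_prop
    have hjd : HasDerivAt j (1, 0) 0 := (hasDerivAt_id 0).prodMk (hasDerivAt_const 0 0)
    have hφc : ContDiffAt ℂ 1 (fun t => A (g (j t))) 0 := by
      refine hAc.contDiffAt.comp 0 (ContDiffAt.comp 0 ?_ hjc.contDiffAt)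
      rwa [hj0]
    have hφ0 : A (g (j 0)) = x := by rw [hj0, hg0, hA0]
    have hev : ∀ᶠ t in 𝓝 (0 : ℂ), F (A (g (j t))) = 0 := by
      have h1 : Filter.Tendsto j (𝓝 0) (𝓝 0) := hjc.continuous.tendsto 0
      filter_upwards [h1.eventually hgr] with t ht
      exact (Prod.ext_iff.1 ht).2
    refine ⟨fun t => A (g (j t)), ?_, hφ0, ?_, ?_⟩
    · rw [Complex.analyticAt_iff_eventually_differentiableAt]
      filter_upwards [hφc.eventually (by simp)] with t ht using ht.differentiableAt one_ne_zero
    · have h1 : Filter.Tendsto (fun t => A (g (j t))) (𝓝 0) (𝓝 x) := by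
        have := hφc.continuousAt.tendsto
        rwa [hφ0] at this
      filter_upwards [hev, h1.eventually hH] with t h2 h3 using h3.2 h2
    · have h1 : HasDerivAt (fun t => g (j t)) (1, 0) 0 := by
        exact hgd.comp_hasDerivAt_of_eq 0 hjd hj0.symm
      have h2 := hAd.comp_hasDerivAt_of_eq 0 h1 (by rw [hj0, hg0])
      refine h2.deriv.trans ?_
      simp [A']

end Tangent

/-! ### The affine conjugacy class -/

theorem differentiableAt_coeff_linear_pow {α β : ℂ → ℂ} {t : ℂ} (hα : DifferentiableAt ℂ α t)
    (hβ : DifferentiableAt ℂ β t) (j i : ℕ) :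
    DifferentiableAt ℂ (fun s => ((C (α s) * X + C (β s)) ^ j).coeff i) t := by
  induction j generalizing i with
  | zero => simp
  | succ j ih =>
    simp only [pow_succ, coeff_mul]
    refine DifferentiableAt.fun_sum fun k _ => (ih k.1).mul ?_
    simp only [coeff_add, coeff_C_mul, coeff_C]
    split_ifs <;> fun_prop

theorem toPoly_comp (P : Coeffs d) (q : ℂ[X]) :
    (toPoly P).comp q = ∑ j : Fin (d + 1), C (P j) * q ^ (j : ℕ) := by
  simp [toPoly_eq_sum, smul_eq_C_mul]

/-- The coefficient vector of the conjugate `A⁻¹ ∘ P ∘ A`, where `A z = α z + β`. -/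
noncomputable def affineConj (P : Coeffs d) (α β : ℂ) : Coeffs d :=
  fun i => (C α⁻¹ * ((toPoly P).comp (C α * X + C β) - C β)).coeff i

theorem polyMap_affineConj (P : Coeffs d) (α β z : ℂ) :
    polyMap (affineConj P α β) z = α⁻¹ * (polyMap P (α * z + β) - β) := by
  have hdeg : (C α⁻¹ * ((toPoly P).comp (C α * X + C β) - C β)).natDegree ≤ d := by
    refine (natDegree_C_mul_le _ _).trans ?_
    rw [natDegree_sub_C, natDegree_comp]
    calc _ ≤ d * 1 := Nat.mul_le_mul (natDegree_toPoly_le P) (natDegree_linear_le)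
      _ = d := mul_one d
  change (toPoly (fun i : Fin (d + 1) =>
    (C α⁻¹ * ((toPoly P).comp (C α * X + C β) - C β)).coeff i)).eval z = _
  rw [toPoly_coeff hdeg]
  simp [polyMap]

theorem polyMap_injective : Function.Injective (polyMap (d := d)) := fun _ _ h =>
  toPoly_injective (Polynomial.funext fun z => congrFun h z)

theorem differentiableAt_affineConj (P : Coeffs d) {α β : ℂ → ℂ} {t : ℂ} (hα : DifferentiableAt ℂ α t)
    (hβ : DifferentiableAt ℂ β t) (h0 : α t ≠ 0) :
    DifferentiableAt ℂ (fun s => affineConj P (α s) (β s)) t := by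
  rw [differentiableAt_pi]
  intro i
  simp only [affineConj, coeff_C_mul, coeff_sub, toPoly_comp, finsetSum_coeff, coeff_C]
  refine (hα.inv h0).mul (DifferentiableAt.sub ?_ ?_)
  · exact DifferentiableAt.fun_sum fun j _ =>
      (differentiableAt_coeff_linear_pow hα hβ j i).const_mul (P j)
  · split_ifs <;> fun_prop

theorem isOpen_polyDeg : IsOpen (polyDeg d) :=
  isOpen_ne_fun (continuous_apply _) continuous_const

/-- The vectors `ξ ∘ P - P' ξ`, with `ξ` an affine vector field, are tangent to the affine
conjugacy class of `P`. -/
theorem mem_tangentVectors_affineOrbit {P v : Coeffs d} (hP : P ∈ polyDeg d) {a b : ℂ}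
    (hv : toPoly v = C b * toPoly P + C a - (toPoly P).derivative * (C b * X + C a)) :
    v ∈ tangentVectors (affineOrbit P) P := by
  -- Conjugating by z - t(bz + a) gives velocity ξ∘P - P'ξ with ξ(z) = bz + a.
  let α : ℂ → ℂ := fun t => 1 - t * b
  let β : ℂ → ℂ := fun t => -(t * a)
  have hα : Differentiable ℂ α := by fun_prop
  have hβ : Differentiable ℂ β := by fun_prop
  have hαne : ∀ᶠ t in 𝓝 (0 : ℂ), α t ≠ 0 := hα.continuous.continuousAt.eventually_ne (by simp [α])
  have hφd : ∀ᶠ t in 𝓝 (0 : ℂ), DifferentiableAt ℂ (fun t => affineConj P (α t) (β t)) t := by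
    filter_upwards [hαne] with t ht using differentiableAt_affineConj P (hα t) (hβ t) ht
  have hφ0 : affineConj P (α 0) (β 0) = P := by
    refine polyMap_injective (_root_.funext fun z => ?_)
    rw [polyMap_affineConj]
    simp [α, β]
  refine ⟨fun t => affineConj P (α t) (β t), Complex.analyticAt_iff_eventually_differentiableAt.2 hφd,
    hφ0, ?_, ?_⟩
  · have hc : ContinuousAt (fun t => affineConj P (α t) (β t)) 0 := hφd.self_of_nhds.continuousAt
    have h1 := hc.eventually (by
      rw [hφ0]; exact isOpen_polyDeg.mem_nhds hP : ∀ᶠ Q in 𝓝 (affineConj P (α 0) (β 0)), Q ∈ polyDeg d)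
    filter_upwards [hαne, h1] with t ht ht'
    refine ⟨ht', α t, β t, ht, fun z => ?_⟩
    rw [polyMap_affineConj]
    field_simp
    ring
  · refine toPoly_injective (Polynomial.funext fun z => ?_)
    have h1 : HasDerivAt (fun t => evalFunctional LinearMap.id z (affineConj P (α t) (β t)))
        (evalFunctional LinearMap.id z (deriv (fun t => affineConj P (α t) (β t)) 0)) 0 :=
      (evalFunctional LinearMap.id z).hasFDerivAt.comp_hasDerivAt 0
        hφd.self_of_nhds.hasDerivAt
    have hα' : HasDerivAt α (-b) 0 := by
      simpa using ((hasDerivAt_id (0 : ℂ)).mul_const b).const_sub 1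
    have hβ' : HasDerivAt β (-a) 0 := by
      simpa using ((hasDerivAt_id (0 : ℂ)).mul_const a).fun_neg
    have hlin : HasDerivAt (fun t => α t * z + β t) (-b * z + -a) 0 := (hα'.mul_const z).add hβ'
    have hcomp : HasDerivAt (fun t => polyMap P (α t * z + β t))
        ((toPoly P).derivative.eval (α 0 * z + β 0) * (-b * z + -a)) 0 :=
      HasDerivAt.comp (h₂ := polyMap P) 0 ((toPoly P).hasDerivAt (α 0 * z + β 0)) hlin
    have h2 := (hα'.fun_inv (by simp [α])).fun_mul (hcomp.fun_sub hβ')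
    have h3 : (fun t => evalFunctional LinearMap.id z (affineConj P (α t) (β t))) =
        fun t => (α t)⁻¹ * (polyMap P (α t * z + β t) - β t) := by
      ext t
      rw [evalFunctional_apply, ← polyMap_affineConj]
      rfl
    rw [h3] at h1
    have h4 := h1.unique h2
    rw [evalFunctional_apply] at h4
    rw [hv]
    refine h4.trans ?_
    simp [α, β, polyMap]
    ring

/-- Compare coefficients of z^d. This determines α only up to (d - 1)-th roots of unity, but bounds
|α| for Q near P. -/
theorem affineOrbit_leadingCoeff {P Q : Coeffs d} (hd : 1 ≤ d) (hP : P ∈ polyDeg d) {α β : ℂ}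
    (hα : α ≠ 0) (h : ∀ z : ℂ, α * polyMap Q z + β = polyMap P (α * z + β)) :
    α ^ (d - 1) = Q (Fin.last d) / P (Fin.last d) := by
  have h1 : C α * toPoly Q + C β = (toPoly P).comp (C α * X + C β) := by
    refine Polynomial.funext fun z => ?_
    simpa [polyMap] using h z
  have hlin : (C α * X + C β : ℂ[X]).natDegree = 1 := natDegree_linear hα
  have h2 := congrArg (fun q : ℂ[X] => q.coeff d) h1
  have h3 : ((toPoly P).comp (C α * X + C β)).coeff d = P (Fin.last d) * α ^ d := by
    have := coeff_comp_degree_mul_degree (p := toPoly P) (q := C α * X + C β) (by rw [hlin]; simp)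
    rw [hlin, natDegree_toPoly hP, mul_one] at this
    rw [this, leadingCoeff, leadingCoeff, natDegree_toPoly hP, hlin,
      show (toPoly P).coeff d = P (Fin.last d) from coeff_toPoly_fin P (Fin.last d)]
    simp
  rw [h3, coeff_add, coeff_C_mul, coeff_C_of_ne_zero (by omega), add_zero,
    show (toPoly Q).coeff d = Q (Fin.last d) from coeff_toPoly_fin Q (Fin.last d)] at h2
  have hP' : P (Fin.last d) ≠ 0 := hP
  rw [eq_div_iff hP']
  have h4 : α ^ d = α * α ^ (d - 1) := by rw [← pow_succ', Nat.sub_add_cancel hd]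
  rw [h4] at h2
  apply mul_left_cancel₀ hα
  linear_combination -h2

/-- Critical orbit relations persist along the affine conjugacy class. -/
theorem eventually_relation_of_affineOrbit (hd : 2 ≤ d) {P : Coeffs d} (hP : P ∈ polyDeg d)
    {V : Set (Coeffs d)} (hVo : IsOpen V) (hPV : P ∈ V) {c : Fin (d - 1) → Coeffs d → ℂ}
    (hc : IsCriticalMarking V c) {i : Fin (d - 1)} {m n : ℕ}
    (hrel : (polyMap P)^[m] (c i P) = (polyMap P)^[n] (c i P)) {φ : ℂ → Coeffs d}
    (hφ : ContinuousAt φ 0) (hφ0 : φ 0 = P) (hφS : ∀ᶠ t in 𝓝 (0 : ℂ), φ t ∈ affineOrbit P) :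
    ∀ᶠ t in 𝓝 (0 : ℂ),
      (polyMap (φ t))^[m] (c i (φ t)) - (polyMap (φ t))^[n] (c i (φ t)) = 0 := by
  subst hφ0
  set P := φ 0 with hPdef
  have hci : DifferentiableAt ℂ (c i) P := (hc.holomorphic i P hPV).differentiableAt
    (hVo.mem_nhds hPV)
  have hcont : ContinuousAt (fun t => 2 *
      ‖(polyMap (φ t))^[m] (c i (φ t)) - (polyMap (φ t))^[n] (c i (φ t))‖) 0 :=
    ((ContinuousAt.comp (g := fun Q => (polyMap Q)^[m] (c i Q))
        (differentiableAt_iterate hci m).continuousAt hφ).sub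
      (ContinuousAt.comp (g := fun Q => (polyMap Q)^[n] (c i Q))
        (differentiableAt_iterate hci n).continuousAt hφ)).norm.const_mul 2
  -- All indices `j` are needed: α need not be near 1, so the conjugacy may send `c i` of the nearby
  -- map to another `c j P`. Finitely many defects of P leave a gap above 0.
  have hgap : ∀ᶠ ε in 𝓝[>] (0 : ℝ), ∀ j, ‖(polyMap P)^[m] (c j P) - (polyMap P)^[n] (c j P)‖ < ε →
      (polyMap P)^[m] (c j P) - (polyMap P)^[n] (c j P) = 0 := by
    refine Filter.eventually_all.2 fun j => ?_
    by_cases h0 : (polyMap P)^[m] (c j P) - (polyMap P)^[n] (c j P) = 0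
    · exact Filter.Eventually.of_forall fun ε _ => h0
    · filter_upwards [Ioo_mem_nhdsGT (norm_pos_iff.2 h0)] with ε hε h
      exact absurd h (not_lt.2 hε.2.le)
  obtain ⟨ε, hε, hε0⟩ := (hgap.and self_mem_nhdsWithin).exists
  have hsmall := hcont.eventually_lt (continuousAt_const (y := ε)) (by
    rw [← hPdef, hrel]; simpa using hε0)
  have hlead : ContinuousAt (fun t => ‖φ t (Fin.last d) / P (Fin.last d)‖) 0 :=
    (((continuous_apply (Fin.last d)).continuousAt.comp hφ).div_const _).norm
  have hlead' := hlead.eventually_lt (continuousAt_const (y := (2 : ℝ))) (by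
    rw [← hPdef, div_self hP]; simp)
  filter_upwards [hφS, hsmall, hlead', hφ.eventually (hVo.mem_nhds hPV)] with t hS h1 h2 hV
  obtain ⟨-, α, β, hα, hconj⟩ := hS
  have hα2 : ‖α‖ < 2 := by
    rw [← affineOrbit_leadingCoeff (by omega) hP hα hconj, norm_pow] at h2
    by_contra! h
    have := le_self_pow₀ (by linarith : 1 ≤ ‖α‖) (by omega : d - 1 ≠ 0)
    linarith
  have hcrit : (toPoly (φ t)).derivative.eval (c i (φ t)) = 0 :=
    (hc.range_eq _ hV).subset ⟨i, rfl⟩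
  obtain ⟨j, hj⟩ : α * c i (φ t) + β ∈ Set.range fun j => c j P := by
    rw [hc.range_eq P hPV]
    have hpoly : C α * toPoly (φ t) + C β = (toPoly P).comp (C α * X + C β) := by
      refine Polynomial.funext fun z => ?_
      simpa [polyMap] using hconj z
    have := congrArg (fun q => (Polynomial.derivative q).eval (c i (φ t))) hpoly
    simp only [derivative_add, derivative_C_mul, derivative_C, add_zero, eval_mul, eval_C, hcrit,
      derivative_comp, derivative_X, mul_one, eval_comp, eval_add, eval_X, mul_zero] at this
    exact (mul_eq_zero.1 this.symm).resolve_left hα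
  have hiter : ∀ k z, α * (polyMap (φ t))^[k] z + β = (polyMap P)^[k] (α * z + β) := by
    intro k
    exact (Function.Semiconj.iterate_right (f := fun z => α * z + β) hconj k)
  -- Conjugation scales the defect by α, with |α| < 2, so the defect of P falls below the gap and
  -- vanishes.
  have hkey : α * ((polyMap (φ t))^[m] (c i (φ t)) - (polyMap (φ t))^[n] (c i (φ t))) =
      (polyMap P)^[m] (c j P) - (polyMap P)^[n] (c j P) := by
    simp only at hj
    rw [hj, ← hiter, ← hiter]
    ring
  have hz := hε j (by
    rw [← hkey, norm_mul]
    refine lt_of_le_of_lt ?_ h1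
    exact mul_le_mul_of_nonneg_right hα2.le (norm_nonneg _))
  rw [← hkey] at hz
  exact (mul_eq_zero.1 hz).resolve_left hα

/-- Every perturbation of `P` is, up to a vector tangent to the affine conjugacy class, a
polynomial of degree at most `d - 2`. -/
theorem exists_affine_correction (hd : 2 ≤ d) {P : Coeffs d} (hP : P ∈ polyDeg d) (v : Coeffs d) :
    ∃ w a b, toPoly w = C b * toPoly P + C a - (toPoly P).derivative * (C b * X + C a) ∧
      (toPoly (v - w)).natDegree < d - 1 := by
  have hPd : (toPoly P).coeff d ≠ 0 := by
    rw [show (toPoly P).coeff d = P (Fin.last d) from coeff_toPoly_fin P (Fin.last d)]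
    exact hP
  have hd1 : (1 : ℂ) - d ≠ 0 := by
    rw [sub_ne_zero]
    exact_mod_cast (by omega : 1 ≠ d)
  have hd0 : (d : ℂ) ≠ 0 := by exact_mod_cast (by omega : d ≠ 0)
  set p := toPoly P with hp
  -- `b` cancels the coefficient of z^d, where the correction contributes (1 - d) p_d b; `a` below
  -- then cancels that of z^(d-1), entering as -d p_d a.
  set b : ℂ := (toPoly v).coeff d / ((1 - d) * p.coeff d) with hb
  obtain ⟨e, rfl⟩ : ∃ e, d = e + 2 := ⟨d - 2, by omega⟩
  let W : ℂ → ℂ[X] := fun a => C b * p + C a - p.derivative * (C b * X + C a)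
  have hW1 : ∀ a, (W a).coeff (e + 2) = b * p.coeff (e + 2) - p.coeff (e + 2) * (e + 2) * b := by
    intro a
    have h0 : p.coeff (e + 2 + 1) = 0 :=
      coeff_eq_zero_of_natDegree_lt (Nat.lt_succ_of_le (natDegree_toPoly_le P))
    simp only [W, mul_add, coeff_sub, coeff_add, coeff_C_mul, coeff_C_of_ne_zero (by omega : e + 2 ≠ 0),
      ← mul_assoc, coeff_mul_X, coeff_mul_C, coeff_derivative, h0]
    push_cast
    ring
  have hW2 : ∀ a, (W a).coeff (e + 1) = (if e + 1 = 0 then a else 0) + b * p.coeff (e + 1) -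
      p.coeff (e + 1) * (e + 1) * b - p.coeff (e + 2) * (e + 2) * a := by
    intro a
    simp only [W, mul_add, coeff_sub, coeff_add, coeff_C_mul, coeff_C,
      ← mul_assoc, coeff_mul_X, coeff_mul_C, coeff_derivative]
    push_cast
    ring
  set a : ℂ := (b * p.coeff (e + 1) - p.coeff (e + 1) * (e + 1) * b - (toPoly v).coeff (e + 1)) /
    (p.coeff (e + 2) * (e + 2)) with ha
  have hpd : p.natDegree = e + 2 := natDegree_toPoly hP
  have hWdeg : (W a).natDegree ≤ e + 2 := by
    have h1 : p.derivative.natDegree ≤ e + 1 := (natDegree_derivative_le p).trans (by omega)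
    refine (natDegree_sub_le _ _).trans (max_le ?_ ?_)
    · refine (natDegree_add_C).le.trans ((natDegree_C_mul_le _ _).trans hpd.le)
    · refine natDegree_mul_le.trans ?_
      have := natDegree_linear_le (a := b) (b := a)
      omega
  refine ⟨fun i => (W a).coeff i, a, b, toPoly_coeff hWdeg, ?_⟩
  rw [toPoly_sub, toPoly_coeff hWdeg, show e + 2 - 1 = e + 1 from rfl, Nat.lt_succ_iff,
    natDegree_le_iff_coeff_eq_zero]
  intro k hk
  rw [coeff_sub]
  push_cast at hd0 hd1 hb
  have hk' : k = e + 1 ∨ k = e + 2 ∨ e + 2 < k := by omega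
  rcases hk' with rfl | rfl | hk'
  · rw [hW2, if_neg (by omega), ha]
    field_simp
    ring
  · rw [hW1, hb]
    field_simp
    ring
  · rw [coeff_eq_zero_of_natDegree_lt ((natDegree_toPoly_le v).trans_lt hk'),
      coeff_eq_zero_of_natDegree_lt (hWdeg.trans_lt hk'), sub_zero]

/-- Simplicity gives P' exactly d - 1 distinct roots, and d - 1 marked points can only cover them
without repetition. -/
theorem IsCriticalMarking.injective (hd : 2 ≤ d) {P : Coeffs d} (hP : P ∈ polyDeg d)
    (hsimple : HasSimpleCriticalPoints P) {V : Set (Coeffs d)} (hPV : P ∈ V)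
    {c : Fin (d - 1) → Coeffs d → ℂ} (hc : IsCriticalMarking V c) :
    Function.Injective (fun i => c i P) := by
  classical
  have hq : (toPoly P).derivative.natDegree = d - 1 := by
    rw [natDegree_derivative, natDegree_toPoly hP]
  have hq0 : (toPoly P).derivative ≠ 0 := by
    intro h
    rw [h, natDegree_zero] at hq
    omega
  have h1 := card_fiber (p := (toPoly P).derivative) (w := 0) (by omega) hsimple
  rw [C_0, sub_zero, hq] at h1
  have h2 : Finset.univ.image (fun i => c i P) = (toPoly P).derivative.roots.toFinset := by
    ext z
    have h3 := Set.ext_iff.1 (hc.range_eq P hPV) z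
    simp only [Set.mem_range, criticalSet, Set.mem_ofPred_eq] at h3
    simp [hq0, h3]
  rw [← h2] at h1
  have h3 : Set.InjOn (fun i => c i P) (Finset.univ : Finset (Fin (d - 1))) :=
    Finset.card_image_iff.1 (by rw [h1]; simp)
  exact fun a b h => h3 (by simp) (by simp) h

end PolyFamily

/-! ### Kernel, smoothness and transversality -/

open PolyFamily

theorem mainTheorem6 (d : ℕ) (hd : 2 ≤ d) (P : PolyFamily.Coeffs d)
    (hP : P ∈ PolyFamily.polyDeg d)
    (hsimple : PolyFamily.HasSimpleCriticalPoints P)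
    (hspcf : PolyFamily.StrictlyPostcriticallyFinite P)
    (V : Set (PolyFamily.Coeffs d)) (hVo : IsOpen V) (hPV : P ∈ V)
    (hVd : V ⊆ PolyFamily.polyDeg d)
    (c : Fin (d - 1) → PolyFamily.Coeffs d → ℂ)
    (hc : PolyFamily.IsCriticalMarking V c)
    (m n : Fin (d - 1) → ℕ) (hn : ∀ i, 1 ≤ n i) (hmn : ∀ i, n i < m i)
    (hdisj : ∀ i j, c i P ≠ c j P → ∀ k l : ℕ,
      (PolyFamily.polyMap P)^[k] (c i P) ≠ (PolyFamily.polyMap P)^[l] (c j P))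
    (hper : ∀ i, ∀ k : ℕ,
      (PolyFamily.polyMap P)^[k] (c i P) ∈ Function.periodicPts (PolyFamily.polyMap P) ↔ n i ≤ k)
    (hperiod : ∀ i, ∀ k : ℕ, n i ≤ k →
      Function.minimalPeriod (PolyFamily.polyMap P) ((PolyFamily.polyMap P)^[k] (c i P))
        = m i - n i) :
    ((LinearMap.ker
        ((fderiv ℂ (PolyFamily.critIterates c n) P
          - fderiv ℂ (PolyFamily.critIterates c m) P :
            PolyFamily.Coeffs d →L[ℂ] (Fin (d - 1) → ℂ)) :
            PolyFamily.Coeffs d →ₗ[ℂ] (Fin (d - 1) → ℂ)) :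
        Submodule ℂ (PolyFamily.Coeffs d)) : Set (PolyFamily.Coeffs d))
      = PolyFamily.tangentVectors (PolyFamily.affineOrbit P) P ∧
    (∀ i, PolyFamily.IsSmoothHypersurfaceAt (PolyFamily.relationHypersurface V c m n i) P) ∧
    PolyFamily.TransverseAt (PolyFamily.relationHypersurface V c m n) P ∧
    LinearIndependent ℂ (fun i : Fin (d - 1) =>
      fderiv ℂ (fun Q => PolyFamily.critIterates c m Q i - PolyFamily.critIterates c n Q i) P) := by
  have hcd : ∀ i, ∀ Q ∈ V, DifferentiableAt ℂ (c i) Q := fun i Q hQ =>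
    (hc.holomorphic i Q hQ).differentiableAt (hVo.mem_nhds hQ)
  have hit : ∀ i k, ∀ Q ∈ V, DifferentiableAt ℂ (fun Q => (polyMap Q)^[k] (c i Q)) Q :=
    fun i k Q hQ => differentiableAt_iterate (hcd i Q hQ) k
  let F : Fin (d - 1) → Coeffs d → ℂ := fun i Q => critIterates c m Q i - critIterates c n Q i
  have hFd : ∀ i, ∀ Q ∈ V, DifferentiableAt ℂ (F i) Q := fun i Q hQ =>
    (hit i (m i) Q hQ).sub (hit i (n i) Q hQ)
  have hFc : ∀ i, ContDiffAt ℂ 1 (F i) P := fun i => by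
    have hcc : ContDiffAt ℂ 1 (c i) P := contDiffAt_criticalPoint hVo (hc.holomorphic i)
      (fun Q hQ => (hc.range_eq Q hQ).subset ⟨i, rfl⟩) hPV
      (hsimple _ ((hc.range_eq P hPV).subset ⟨i, rfl⟩))
    exact (contDiffAt_iterate hcc (m i)).sub (contDiffAt_iterate hcc (n i))
  have hrel : ∀ i, (polyMap P)^[m i] (c i P) = (polyMap P)^[n i] (c i P) := fun i => by
    have h1 := Function.iterate_minimalPeriod (f := polyMap P) (x := (polyMap P)^[n i] (c i P))
    rwa [hperiod i (n i) le_rfl, ← Function.iterate_add_apply,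
      Nat.sub_add_cancel (hmn i).le] at h1
  have hF0 : ∀ i, F i P = 0 := fun i => sub_eq_zero.2 (hrel i)
  have hFv : ∀ i v, fderiv ℂ (F i) P v = fderiv ℂ (fun Q => (polyMap Q)^[m i] (c i Q)) P v -
      fderiv ℂ (fun Q => (polyMap Q)^[n i] (c i Q)) P v := fun i v => by
    have : fderiv ℂ (F i) P = _ :=
      ((hit i (m i) P hPV).hasFDerivAt.sub (hit i (n i) P hPV).hasFDerivAt).fderiv
    rw [this]
    rfl
  have hker : ∀ v, (fderiv ℂ (critIterates c n) P - fderiv ℂ (critIterates c m) P :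
      Coeffs d →L[ℂ] (Fin (d - 1) → ℂ)) v = 0 ↔ ∀ i, fderiv ℂ (F i) P v = 0 := fun v => by
    have h1 : ∀ k : Fin (d - 1) → ℕ, fderiv ℂ (critIterates c k) P = ContinuousLinearMap.pi
        fun i => fderiv ℂ (fun Q => (polyMap Q)^[k i] (c i Q)) P := fun k =>
      (hasFDerivAt_pi.2 fun i => (hit i (k i) P hPV).hasFDerivAt).fderiv
    rw [h1, h1, funext_iff]
    refine forall_congr' fun i => ?_
    rw [hFv]
    change _ - _ = (0 : ℂ) ↔ _
    rw [sub_eq_zero, sub_eq_zero]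
    exact eq_comm
  have hslice : ∀ u : Coeffs d, (toPoly u).natDegree < d - 1 → (∀ i, fderiv ℂ (F i) P u = 0) →
      u = 0 := by
    intro u hu hu0
    have hq : (toPoly P).derivative.natDegree = d - 1 := by
      rw [natDegree_derivative, natDegree_toPoly hP]
    have hcrit : ∀ z, (toPoly P).derivative.eval z = 0 ↔ ∃ i, c i P = z := fun z =>
      (Set.ext_iff.1 (hc.range_eq P hPV) z).symm
    have := eq_zero_of_critical_relations_preserved (p := toPoly P) (u := toPoly u)
      (by rw [natDegree_toPoly hP]; exact hd) hsimple (c := fun i => c i P)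
      (hc.injective hd hP hsimple hPV) hcrit (fun i => (hspcf _ ((hcrit _).2 ⟨i, rfl⟩)).1)
      hdisj hn hmn hper hperiod (by rw [hq]; exact hu)
      (ζ := fun i k => fderiv ℂ (fun Q => (polyMap Q)^[k] (c i Q)) P u)
      (fun i k => fderiv_iterate_succ (hcd i P hPV) k u)
      (fun i => sub_eq_zero.1 ((hFv i u).symm.trans (hu0 i)))
    refine toPoly_injective (this.trans ?_)
    simp [toPoly_eq_sum]
  have htan : ∀ v ∈ tangentVectors (affineOrbit P) P, ∀ i, fderiv ℂ (F i) P v = 0 := fun v hv i =>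
    fderiv_eq_zero_of_mem_tangentVectors (hFd i P hPV) hv fun φ hφ hφ0 hφS =>
      eventually_relation_of_affineOrbit hd hP hVo hPV hc (hrel i) hφ hφ0 hφS
  let L : Coeffs d →ₗ[ℂ] (Fin (d - 1) → ℂ) := LinearMap.pi fun i => (fderiv ℂ (F i) P : _ →ₗ[ℂ] ℂ)
  have hL : ∀ v i, L v i = fderiv ℂ (F i) P v := fun _ _ => rfl
  have hsurj : Function.Surjective L := by
    -- `e` includes the slice of degree at most d - 2. By `hslice`, `L ∘ₗ e` is an injective
    -- endomorphism of a finite-dimensional space, hence surjective.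
    let e : (Fin (d - 1) → ℂ) →ₗ[ℂ] Coeffs d :=
      LinearMap.pi fun j => if h : (j : ℕ) < d - 1 then LinearMap.proj ⟨j, h⟩ else 0
    have he : ∀ w j, e w j = if h : (j : ℕ) < d - 1 then w ⟨j, h⟩ else 0 := fun w j => by
      simp only [e, LinearMap.pi_apply]
      split_ifs <;> rfl
    have hinj : Function.Injective (L ∘ₗ e) := by
      rw [← LinearMap.ker_eq_bot, LinearMap.ker_eq_bot']
      intro w hw
      have hdeg : (toPoly (e w)).natDegree < d - 1 := by
        rw [Nat.lt_iff_le_pred (by omega), natDegree_le_iff_coeff_eq_zero]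
        intro k hk
        rw [coeff_toPoly]
        split_ifs with h
        · rw [he, dif_neg (by simp only; omega)]
        · rfl
      have h0 := hslice (e w) hdeg fun i => congrFun hw i
      ext i
      have h1 := congrFun h0 ⟨i, by omega⟩
      rw [he, dif_pos i.2] at h1
      exact h1
    exact Function.Surjective.of_comp (LinearMap.injective_iff_surjective.1 hinj)
  have hFne : ∀ i, fderiv ℂ (F i) P ≠ 0 := fun i h => by
    obtain ⟨v, hv⟩ := hsurj (Pi.single i 1)
    have := congrFun hv i
    rw [hL, h, Pi.single_eq_same] at this
    exact zero_ne_one this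
  have hPH : ∀ i, ∀ᶠ Q in 𝓝 P, Q ∈ relationHypersurface V c m n i ↔ F i Q = 0 := fun i => by
    filter_upwards [hVo.mem_nhds hPV] with Q hQ
    exact ⟨fun h => sub_eq_zero.2 h.2, fun h => ⟨hQ, sub_eq_zero.1 h⟩⟩
  have htangent : ∀ i, tangentSpaceAt (relationHypersurface V c m n i) P =
      LinearMap.ker (fderiv ℂ (F i) P : Coeffs d →ₗ[ℂ] ℂ) := fun i =>
    tangentSpaceAt_eq_ker (hFc i) (hF0 i) (hFne i) (hPH i)
  refine ⟨?_, fun i => ?_, ?_, ?_⟩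
  · ext v
    refine (hker v).trans ⟨fun hv => ?_, htan v⟩
    -- `v - w` lies in the slice and in the kernel, so it is 0 and `v` is the tangent vector `w`.
    obtain ⟨w, a, b, hw, hdeg⟩ := exists_affine_correction hd hP v
    have hwt := mem_tangentVectors_affineOrbit hP hw
    have h0 := hslice (v - w) hdeg fun i => by rw [map_sub, hv i, htan w hwt i, sub_zero]
    rwa [sub_eq_zero.1 h0]
  · refine ⟨⟨hPV, hrel i⟩, V, F i, hVo, hPV, fun Q hQ => (hFd i Q hQ).differentiableWithinAt, ?_,
      hFne i⟩
    ext Q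
    exact ⟨fun h => ⟨h.2, sub_eq_zero.2 h.1.2⟩, fun h => ⟨⟨h.1, sub_eq_zero.1 h.2⟩, h.1⟩⟩
  · have h1 : (⨅ i, tangentSpaceAt (relationHypersurface V c m n i) P) = LinearMap.ker L := by
      simp only [htangent]
      rw [LinearMap.ker_pi]
    have h2 : ∀ i, Module.finrank ℂ
        (Coeffs d ⧸ tangentSpaceAt (relationHypersurface V c m n i) P) = 1 := fun i => by
      rw [htangent]
      have hs : Function.Surjective (fderiv ℂ (F i) P : Coeffs d →ₗ[ℂ] ℂ) := fun z => by
        obtain ⟨v, hv⟩ := hsurj fun _ => z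
        exact ⟨v, congrFun hv i⟩
      rw [(LinearMap.quotKerEquivOfSurjective _ hs).finrank_eq, Module.finrank_self]
    rw [TransverseAt, h1, (LinearMap.quotKerEquivOfSurjective _ hsurj).finrank_eq]
    simp [h2]
  · rw [Fintype.linearIndependent_iff]
    intro g hg i
    obtain ⟨v, hv⟩ := hsurj (Pi.single i 1)
    have h1 := DFunLike.congr_fun hg v
    have h2 : ∑ j, g j * L v j = 0 := by
      simpa [hL] using h1
    simpa [hv, Pi.single_apply] using h2
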